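/- **Setting.** A phase of the Byzantine random walk protocol on a dynamic network consists of $2W$ synchronous rounds, $W=\lfloor \frac{\eta}{2}\log n\rfloor$. The network $G_r=(V_r,E_r)$ may change from round to round; let $G_{t'}$ and $G_t$ be the networks at the start and at the end, $N=|V_{t'}|$, with $\log N=\Theta(\log n)$ where $n$ is the parameter known to the protocol. All degrees are at most a constant $\Delta$ at all times. Some nodes are Byzantine; $B_{t'}$, $B_t$ are the Byzantine nodes present at the start and at the end, and $D=D_{t',t}$ is the set of nodes that join or leave during the phase. A *core* $C=(V_C,E_C)$ is an induced subgraph of $G_{t'}$ on honest nodes that stay during the whole phase, whose links among each other do not change during the phase, with conductance at least a constant $\varphi>0$, and with $|V_{t'}\setminus V_C|=O(|B_{t'}|+|D|)$, where $|B_{t'}|+|D|=o(N)$. It has core mixing time (accuracy $1/N^3$ in the maximum norm, from every initial distribution, for the simple random walk on $C$) at most $\tau_C\le b\log n$, $b$ a constant. Write $|C|=|V_C|$ and $\kappa=(|B_t|+|D|)\log n/|C|$. *Walk stage* (rounds $1,\dots,W$). At the start each honest node creates at most $\mathsf{numtokens}=\lfloor\log^3 n\rfloor$ tokens with step counter $0$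 and puts each into the FIFO buffer towards a uniformly random neighbour. In each round every honest node sends the first $\mathsf{cap}=\lfloor a\log^3 n\rfloor$ tokens of each of its buffers, accepts at most $\mathsf{cap}$ tokens from each neighbour (a neighbour that sends more is ignored from then on), increases the counter of every accepted token, and either ends and verifies the token, if the counter has reached $\mathsf{rwLength}=2\tau_C$, or puts it into the buffer towards a fresh, independent, uniformly random current neighbour. *Way back* (rounds $W+1,\dots,2W$). The verified tokens retrace their walks, the rounds of the walk stage being undone in reverse order. A Byzantine adversary that knows the whole history (including the contents of all buffers) chooses adaptively everything that Byzantine nodes send, the order in which tokens received in the same round are handled, and all changes of the network outside the core. $R(C)$ is the number of tokens created by core nodes. A token *walks only in $C$* if every step drawn for it during the phase is a step between core nodes. For a core token $w$, the *core-conditioned execution* of $w$ is the execution in which each single random choice of the next node for $w$ is conditioned on being a core node (so that at each core node $w$ chooses a uniformly random core neighbour), everything else being unchanged. **Theorem 2 (Byzantine Random Walk Theorem).** If the constants $a$ and $\eta$ are large enough, then for every constant $\gamma$ and all sufficiently large $n$, with probability at least $1-N^{-\gamma}$ the following hold simultaneously: 1. During the walk stage, tokens enter or leave the core at most $O(\kappa\cdot\mathsf{numtokens}\cdot|C|)$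 times. 2. At least $R(C)-O(\kappa\cdot\mathsf{numtokens}\cdot|C|)$ of the tokens created in the core walk only in $C$. Each token created in the core that walks only in $C$ walks at least $\tau_C$ steps within the first $2\tau_C$ rounds, and finishes its walk of $\mathsf{rwLength}$ steps, at a core node, within $2\,\mathsf{rwLength}=O\big(\frac{\mathsf{numtokens}}{\mathsf{cap}}\tau_C\big)\le\frac{\eta}{2}\log n$ rounds. 3. Each token created in the core that walks only in $C$ and ends at a core node $u$ is back at its source, verified by $u$, at the end of the phase, that is within $\eta\log n$ rounds in total. Moreover, 4. for every token $w$ created in the core and every $u\in V_C$, the probability $p$ that $w$ ends at $u$ in the core-conditioned execution of $w$ satisfies $$\Big|p-\frac{\deg_C(u)}{2|E_C|}\Big|\le\frac1{N^3},\qquad p=\Theta\Big(\frac1{|C|}\Big)=\Theta\Big(\frac1{N}\Big).$$ The implied constants depend only on $\varphi,b,\Delta$, the constants and functions in the assumptions on $N$ and on the core, and on $a,\eta$ (not on $\gamma$). -/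

import Mathlib

open scoped Classical
open Finset

noncomputable section

namespace ByzWalk

/-! ## Finite graphs: conductance and mixing of the simple random walk -/

/-- The volume of a set of nodes. -/
def vol {W : Type} [Fintype W] (H : SimpleGraph W) (A : Finset W) : ℕ :=
  ∑ v ∈ A, H.degree v

/-- The conductance of `H` is at least `φ`: every non-empty `A` with `|A| ≤ |W| / 2` satisfies
`|E(A, Aᶜ)| / min (vol A) (vol Aᶜ) ≥ φ`.  (For `φ > 0` a set of volume `0` violates this.) -/
def ConductanceAtLeast {W : Type} [Fintype W] (H : SimpleGraph W) (φ : ℝ) : Prop :=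
  ∀ A : Finset W, A.Nonempty → 2 * A.card ≤ Fintype.card W →
    φ ≤ ((H.interedges A Aᶜ).card : ℝ) / ((min (vol H A) (vol H Aᶜ) : ℕ) : ℝ)

/-- Transition matrix of the simple random walk on `H`. -/
def walkMatrix {W : Type} [Fintype W] (H : SimpleGraph W) : Matrix W W ℝ :=
  fun u v => if H.Adj u v then 1 / (H.degree u : ℝ) else 0

/-- The stationary distribution `deg(u) / (2 |E|)` of the simple random walk on `H`. -/
def stationary {W : Type} [Fintype W] (H : SimpleGraph W) (u : W) : ℝ :=
  (H.degree u : ℝ) / (2 * (H.edgeFinset.card : ℝ))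

/-- After `t` steps the simple random walk on `H`, from any initial distribution, is within `ε`
of the stationary distribution in the maximum norm (that is, the mixing time of `H` with accuracy
`ε` is at most `t`). -/
def MixedBy {W : Type} [Fintype W] (H : SimpleGraph W) (ε : ℝ) (t : ℕ) : Prop :=
  ∀ p ∈ stdSimplex ℝ W, ∀ u : W,
    |(Matrix.vecMul p (walkMatrix H ^ t)) u - stationary H u| ≤ ε

/-! ## Networks, tokens, configurations, adversaries -/

variable {V : Type}

/-- A snapshot of the dynamic network: the nodes that are present and the links between them. -/
structure Snapshot (V : Type) where
  alive : Finset V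
  graph : SimpleGraph V
  adj_alive : ∀ u v, graph.Adj u v → u ∈ alive

/-- A token.  `origin = some (v, i)` marks the `i`-th token created by the honest node `v`, as a
physical object; whatever a Byzantine node sends has `origin = none`.  The protocol never reads
`origin`: it only serves to say which token is which. -/
structure Token (V : Type) where
  origin : Option (V × ℕ)
  /-- the number of steps walked (`rwCounter`) -/
  counter : ℕ
  /-- the walk recorded so far, latest step first: from which node, in which round -/
  trail : List (V × ℕ)
  /-- the node that verified the token, once the walk has ended -/
  dest : Option V

/-- The global configuration at the end of a round. -/
structure Config (V : Type) where
  /-- the network in force during the round -/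
  net : Snapshot V
  /-- `moved u v`: the walking tokens sent by `u` in this round and accepted by `v` -/
  moved : V → V → List (Token V)
  /-- `outbox u v`: the FIFO buffer of the honest node `u` towards `v`, head first -/
  outbox : V → V → List (Token V)
  /-- `black u v`: `u` has blacklisted `v` -/
  black : V → V → Prop
  /-- `ended u`: the tokens whose walk ended at `u` (they are recorded and verified by `u`) -/
  ended : V → List (Token V)
  /-- `back u`: the verified tokens that are at `u` on their way back to their source -/
  back : V → List (Token V)

/-- All configurations so far, the latest one first. -/
abbrev History (V : Type) := List (Config V)

/-- The adversary sees everything that has happened so far (all buffers, hence also what the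
honest nodes are about to send in the coming round) and decides on:
* the network in the next round (arrivals, departures, links);
* what the Byzantine node `u` sends to `v` in the next round of the walk stage;
* in which order a node handles the tokens that it receives in one round;
* on the way back: whether the Byzantine node `u` hands back to `v` the `i`-th of the tokens that
  `v` sent to `u` in the round being retraced, and with which destination. -/
structure Adversary (V : Type) where
  net : History V → Snapshot V
  send : History V → V → V → List (Token V)
  order : History V → V → List (Token V) → List (Token V)
  order_perm : ∀ h v l, (order h v l).Perm l
  giveBack : History V → V → V → ℕ → Option V

/-- The data of one phase. -/
structure Phase (V : Type) where
  /-- the Byzantine nodes, among all potential nodes -/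
  byz : Finset V
  /-- the network at the start of the phase -/
  start : Snapshot V
  /-- the blacklists at the start of the phase; only Byzantine nodes are ever blacklisted -/
  black : V → V → Prop
  black_byz : ∀ u v, black u v → v ∈ byz
  /-- the number of tokens created by each (honest) node -/
  init : V → ℕ
  cap : ℕ
  rwLength : ℕ
  /-- the number of rounds of the walk stage; the way back takes the same number of rounds -/
  half : ℕ
  adv : Adversary V

/-! ## Random choices -/

/-- The neighbours of `u` in a snapshot. -/
def nbrs [Fintype V] (S : Snapshot V) (u : V) : Finset V := S.graph.neighborFinset u

/-- A uniformly random neighbour of `u` (a node without neighbours has nowhere to send to). -/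
def pick [Fintype V] (S : Snapshot V) (u : V) : PMF V :=
  if h : (nbrs S u).Nonempty then PMF.uniformOfFinset (nbrs S u) h else PMF.pure u

/-- The law of `pick S u` conditioned on the outcome lying in `C` (if this is possible). -/
def condPick [Fintype V] (C : Finset V) (S : Snapshot V) (u : V) : PMF V :=
  if h : ∃ a ∈ (C : Set V), a ∈ (pick S u).support then (pick S u).filter (C : Set V) h
  else pick S u

/-- How a node chooses the next node for a token. -/
abbrev Rule (V : Type) := Snapshot V → V → Token V → PMF V

/-- The rule of the protocol: a uniformly random neighbour, independently for every token. -/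
def protocolRule [Fintype V] : Rule V := fun S u _ => pick S u

/-- The same, except that every single choice made for the token `w` is conditioned on lying in
`C`; nothing else is changed. -/
def conditionedRule [Fintype V] (C : Finset V) (w : V × ℕ) : Rule V :=
  fun S u t => if t.origin = some w then condPick C S u else pick S u

/-! ## The protocol -/

/-- The part of a configuration that changes when tokens are handled. -/
structure Buffers (V : Type) where
  outbox : V → V → List (Token V)
  ended : V → List (Token V)

/-- Node `x.1` handles the token `x.2`: it ends the walk and verifies the token if the walk has
its full length, and otherwise draws the next node and appends the token to that buffer. -/
def handle (P : Phase V) (rule : Rule V) (S : Snapshot V) (x : V × Token V) (s : Buffers V) :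
    PMF (Buffers V) :=
  if P.rwLength ≤ x.2.counter then
    PMF.pure { s with
      ended := Function.update s.ended x.1 (s.ended x.1 ++ [{ x.2 with dest := some x.1 }]) }
  else
    (rule S x.1 x.2).map fun v => { s with
      outbox := Function.update s.outbox x.1
        (Function.update (s.outbox x.1) v (s.outbox x.1 v ++ [x.2])) }

/-- Handle a list of tokens one after the other. -/
def handleAll (P : Phase V) (rule : Rule V) (S : Snapshot V) :
    List (V × Token V) → Buffers V → PMF (Buffers V)
  | [], s => PMF.pure s
  | x :: xs, s => (handle P rule S x s).bind (handleAll P rule S xs)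

/-- The tokens created by `v` at the start of the phase. -/
def created (P : Phase V) (v : V) : List (Token V) :=
  if v ∈ P.start.alive ∧ v ∉ P.byz then
    (List.range (P.init v)).map fun i => ⟨some (v, i), 0, [], none⟩
  else []

/-- The start of the phase: every honest node creates its tokens, and draws for each of them the
first step. -/
def startLaw [Fintype V] (P : Phase V) (rule : Rule V) : PMF (History V) :=
  (handleAll P rule P.start
      ((univ : Finset V).toList.flatMap fun v => (created P v).map fun t => (v, t))
      ⟨fun _ _ => [], fun _ => []⟩).map
    fun s => [⟨P.start, fun _ _ => [], s.outbox, P.black, s.ended, s.ended⟩]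

/-- What `u` sends to `v` in the round of the walk stage that follows the history `h` with latest
configuration `c`, in the network `S`: an honest node dequeues up to `cap` tokens from its buffer,
a Byzantine node sends anything. -/
def sent (P : Phase V) (h : History V) (c : Config V) (S : Snapshot V) (u v : V) :
    List (Token V) :=
  if S.graph.Adj u v then
    if u ∈ P.byz then (P.adv.send h u v).map fun t => { t with origin := none }
    else (c.outbox u v).take P.cap
  else []

/-- What `v` accepts from `u`: at most `cap` tokens, and nothing from a blacklisted node. -/
def accepted (P : Phase V) (h : History V) (c : Config V) (S : Snapshot V) (u v : V) :
    List (Token V) :=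
  if c.black v u then [] else (sent P h c S u v).take P.cap

/-- The tokens that the honest node `v` has to handle in the round that follows `h`, with their
counter increased and the step recorded. -/
def received [Fintype V] (P : Phase V) (h : History V) (c : Config V) (S : Snapshot V) (v : V) :
    List (Token V) :=
  if v ∈ P.byz then [] else
    P.adv.order h v ((univ : Finset V).toList.flatMap fun u =>
      (accepted P h c S u v).map fun t =>
        { t with counter := t.counter + 1, trail := (u, h.length) :: t.trail })

/-- What remains in the buffer of `u` towards `v` after sending.  (Nodes have buffers for their
present neighbours only.) -/
def kept (P : Phase V) (c : Config V) (S : Snapshot V) (u v : V) : List (Token V) :=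
  if S.graph.Adj u v ∧ u ∉ P.byz then (c.outbox u v).drop P.cap else []

/-- One round of the walk stage. -/
def walkRound [Fintype V] (P : Phase V) (rule : Rule V) (h : History V) (c : Config V) :
    PMF (Config V) :=
  let S := P.adv.net h
  (handleAll P rule S
      ((univ : Finset V).toList.flatMap fun v => (received P h c S v).map fun t => (v, t))
      ⟨kept P c S, c.ended⟩).map
    fun s =>
      { net := S
        moved := accepted P h c S
        outbox := s.outbox
        black := fun v u => c.black v u ∨ P.cap < (sent P h c S u v).length
        ended := s.ended
        back := s.ended }

/-- The configuration at the end of round `r`. -/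
def configAt (h : History V) (r : ℕ) : Option (Config V) := h.reverse[r]?

/-- The tokens that moved from `u` to `v` in round `r`. -/
def movedAt (h : History V) (r : ℕ) (u v : V) : List (Token V) :=
  match configAt h r with
  | none => []
  | some c => c.moved u v

/-- The verified tokens that pass from `u` back to `z` while the steps of round `s` of the walk
stage are retraced: the honest node `u` returns the tokens that it got from `z` in round `s`; the
Byzantine node `u` returns what it likes among the tokens that it got from `z` in round `s`. -/
def returned (P : Phase V) (h : History V) (c : Config V) (S : Snapshot V) (s : ℕ) (u z : V) :
    List (Token V) :=
  if S.graph.Adj u z then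
    if u ∈ P.byz then
      (movedAt h s z u).zipIdx.filterMap fun x =>
        (P.adv.giveBack h u z x.2).map fun d => { x.1 with dest := some d }
    else
      ((c.back u).filter fun t => t.trail.head? = some (z, s)).map
        fun t => { t with trail := t.trail.tail }
  else []

/-- One round of the way back: the round that follows `half + j - 1` rounds undoes the steps that
were made in round `half + 1 - j` of the walk stage. -/
def returnRound [Fintype V] (P : Phase V) (h : History V) (c : Config V) : Config V :=
  let S := P.adv.net h
  let s := 2 * P.half + 1 - h.length
  { net := S
    moved := fun _ _ => []
    outbox := c.outbox
    black := c.black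
    ended := c.ended
    back := fun v => if v ∈ P.byz then [] else
      ((c.back v).filter fun t => ¬ ∃ z, S.graph.Adj v z ∧ t.trail.head? = some (z, s)) ++
      (univ : Finset V).toList.flatMap fun u => returned P h c S s u v }

/-- One round: the first `half` rounds form the walk stage, the others the way back. -/
def nextRound [Fintype V] (P : Phase V) (rule : Rule V) (h : History V) : PMF (History V) :=
  match h with
  | [] => PMF.pure []
  | c :: _ =>
    if h.length ≤ P.half then (walkRound P rule h c).map fun c' => c' :: h
    else PMF.pure (returnRound P h c :: h)

/-- The law of the history of the first `r` rounds. -/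
def execution [Fintype V] (P : Phase V) (rule : Rule V) : ℕ → PMF (History V)
  | 0 => startLaw P rule
  | r + 1 => (execution P rule r).bind (nextRound P rule)

/-- The law of the history of the whole phase, when all honest nodes run the protocol. -/
def Phase.law [Fintype V] (P : Phase V) : PMF (History V) :=
  execution P protocolRule (2 * P.half)

/-- The law of the history of the whole phase, when each single random choice of the next node of
the token `w` is conditioned on staying in `C`. -/
def Phase.condLaw [Fintype V] (P : Phase V) (C : Finset V) (w : V × ℕ) : PMF (History V) :=
  execution P (conditionedRule C w) (2 * P.half)

/-! ## The core, and what the result is about -/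

/-- The core as a graph: the subgraph of the initial network induced on `C`. -/
def Phase.coreGraph (P : Phase V) (C : Finset V) : SimpleGraph C :=
  P.start.graph.induce (C : Set V)

/-- The Byzantine nodes at the start of the phase. -/
def Phase.byzStart (P : Phase V) : Finset V := P.byz ∩ P.start.alive

/-- The Byzantine nodes at the end of the history. -/
def Phase.byzEnd (P : Phase V) (h : History V) : Finset V :=
  match h with
  | [] => ∅
  | c :: _ => P.byz ∩ c.net.alive

/-- The nodes that joined or left during the history. -/
def churned [Fintype V] (h : History V) : Finset V :=
  univ.filter fun v => (∃ c ∈ h, v ∈ c.net.alive) ∧ (∃ c ∈ h, v ∉ c.net.alive)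

/-- `C` is (the node set of) a core of the phase: honest nodes that are present during the whole
phase, whose links among each other do not change during the phase and form a graph of conductance
at least `φ`, and which are all nodes present at the start but at most `K (|B| + |D|)`.  The
network has degree at most `Δ` throughout, and `|B| + |D| ≤ f`. -/
structure IsCore [Fintype V] (P : Phase V) (C : Finset V) (φ : ℝ) (Δ K : ℕ) (f : ℝ) : Prop where
  honest : Disjoint C P.byz
  alive_start : C ⊆ P.start.alive
  alive : ∀ h, C ⊆ (P.adv.net h).alive
  static : ∀ h, ∀ u ∈ C, ∀ v ∈ C, (P.adv.net h).graph.Adj u v ↔ P.start.graph.Adj u v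
  expander : ConductanceAtLeast (P.coreGraph C) φ
  degree_start : ∀ u, (nbrs P.start u).card ≤ Δ
  degree : ∀ h u, (nbrs (P.adv.net h) u).card ≤ Δ
  size : ∀ h ∈ P.law.support,
    (P.start.alive \ C).card ≤ K * (P.byzStart.card + (churned h).card)
  few : ∀ h ∈ P.law.support, ((P.byzStart.card + (churned h).card : ℕ) : ℝ) ≤ f

/-- `κ = (|B_t| + |D_{t',t}|) log n / |C|`. -/
def kappa [Fintype V] (P : Phase V) (C : Finset V) (n : ℕ) (h : History V) : ℝ :=
  (((P.byzEnd h).card : ℝ) + ((churned h).card : ℝ)) * Real.log n / (C.card : ℝ)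

/-- The total number of times that a walking token enters or leaves `C`. -/
def crossings [Fintype V] (C : Finset V) (h : History V) : ℕ :=
  (h.map fun c => ∑ u ∈ C, ∑ v ∈ Cᶜ, ((c.moved u v).length + (c.moved v u).length)).sum

/-- The tokens created by the nodes of `C`; their number is `R(C)`. -/
def Phase.tokens (P : Phase V) (C : Finset V) : Finset (V × ℕ) :=
  C.biUnion fun v => (range (P.init v)).image fun i => (v, i)

/-- The token `w` walks only in `C`: every step that was ever drawn for it is a step inside `C`. -/
def WalksIn (C : Finset V) (h : History V) (w : V × ℕ) : Prop :=
  ∀ c ∈ h, ∀ u v, ∀ t ∈ c.outbox u v, t.origin = some w → u ∈ C ∧ v ∈ C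

/-- By the end of round `r`, the token `w` has walked at least `k` steps. -/
def WalkedBy (h : History V) (w : V × ℕ) (r k : ℕ) : Prop :=
  ∃ c, configAt h r = some c ∧ ∃ t : Token V,
    (∃ u, t ∈ c.ended u ∨ ∃ v, t ∈ c.outbox u v) ∧ t.origin = some w ∧ k ≤ t.counter

/-- By the end of round `r`, the walk of the token `w` has ended, at `u`, after `k` steps. -/
def EndedBy (h : History V) (w : V × ℕ) (r k : ℕ) (u : V) : Prop :=
  ∃ c, configAt h r = some c ∧ ∃ t ∈ c.ended u, t.origin = some w ∧ t.counter = k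

/-- During the history, the walk of the token `w` ended at `u`. -/
def EndsAt (h : History V) (w : V × ℕ) (u : V) : Prop :=
  ∃ c ∈ h, ∃ t ∈ c.ended u, t.origin = some w

/-- By the end of round `r`, the token `w` is back at its source, verified by `u`. -/
def BackBy (h : History V) (w : V × ℕ) (r : ℕ) (u : V) : Prop :=
  ∃ c, configAt h r = some c ∧ ∃ t ∈ c.back w.1,
    t.origin = some w ∧ t.trail = [] ∧ t.dest = some u

/-- `numtokens = log³ n`. -/
def numtokens (n : ℕ) : ℕ := ⌊Real.log n ^ 3⌋₊

end ByzWalk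

end

/-! The only random event that matters for the high-probability claims is that no buffer between
core nodes ever exceeds `2 * cap` tokens during the walk stage (`QueueBounded`). Everything else in
them is deterministic, so the adversary's adaptivity costs nothing there.

Crossings and escapes are bounded surely. Every link out of the core ends at a present node outside
it, of degree at most `Δ`, and carries at most `cap` tokens per round in each direction. A token can
leave the core only when it is handled at a boundary node, which receives at most `Δ * cap` tokens
per round. At any time there are at most `(2K+1)(|B_t| + |D|)` present nodes outside the core
(`card_alive_sdiff_le`), and summing over the `O(log n)` rounds gives `crossings_le` and
`card_escaped_le`.

Bounded buffers follow from an exponential moment. However hard the Byzantine nodes flood it, a core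
node with `d` neighbours accepts at most `d * cap` tokens per round and sends each to a uniform
neighbour. So each of its buffers gains at most `cap` tokens in expectation, just what it sends.
With `δ` of order one over the number of rounds, `E (1+δ)^length` stays close to `(1+δ)^cap`
(`expect_pow_queueLength_le`). Markov's inequality at length `2 * cap` and a union bound leave a
failure probability `exp(-Ω(cap / rounds)) = exp(-Ω(log² n))` up to polynomial factors. This beats
every `N^(-γ)` without a change of `a` or `η`.

Given bounded buffers, a token staying in the core waits at most one extra round per step, so it
ends within `2 * rwLength` rounds of the walk stage (`located_of_mem_support`). Its recorded trail
uses static core links in decreasing rounds, so the reversed rounds bring it home (`retraces`).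

For the end point, let `q` be the law of the simple random walk on the core after `rwLength` steps,
and `p` the law of the end of `w` in the core-conditioned execution. The adversary controls when `w`
moves but not its draws, so the conditional probability of ending at `u` is a supermartingale (it
only loses mass with lost tokens), whence `p ≤ q` pointwise. Since `w` ends somewhere in the core
unless a buffer is long, the masses of `p` and `q` differ by at most the failure probability, and a
pointwise inequality with nearly equal masses gives closeness (`abs_endsAt_sub_stepProb_le`).
Walking twice the mixing time squares the accuracy, which makes room for this error within `1 /
N^3`. -/

noncomputable section

namespace ByzWalk

open scoped ENNReal

/-! ## Expectations of nonnegative functions -/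

section Expect

variable {α β : Type}

/-- The expectation of `f` under `p`. -/
def expect (p : PMF α) (f : α → ℝ≥0∞) : ℝ≥0∞ := ∑' x, p x * f x

theorem expect_pure (a : α) (f : α → ℝ≥0∞) : expect (PMF.pure a) f = f a := by
  unfold expect
  rw [tsum_eq_single a]
  · simp
  · intro b hb
    simp [PMF.pure_apply, hb]

theorem expect_bind (p : PMF α) (q : α → PMF β) (f : β → ℝ≥0∞) :
    expect (p.bind q) f = expect p fun x => expect (q x) f := by
  simp only [expect, PMF.bind_apply, ← ENNReal.tsum_mul_right, ← ENNReal.tsum_mul_left]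
  rw [ENNReal.tsum_comm]
  simp only [mul_assoc]

theorem expect_map (p : PMF α) (g : α → β) (f : β → ℝ≥0∞) :
    expect (p.map g) f = expect p fun x => f (g x) := by
  simp only [PMF.map, expect_bind, Function.comp_apply, expect_pure]

theorem expect_mono {p : PMF α} {f g : α → ℝ≥0∞} (h : ∀ x ∈ p.support, f x ≤ g x) :
    expect p f ≤ expect p g := by
  refine ENNReal.tsum_le_tsum fun x => ?_
  by_cases hx : p x = 0
  · simp [hx]
  · gcongr
    exact h x hx

theorem expect_congr {p : PMF α} {f g : α → ℝ≥0∞} (h : ∀ x ∈ p.support, f x = g x) :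
    expect p f = expect p g :=
  le_antisymm (expect_mono fun x hx => (h x hx).le) (expect_mono fun x hx => (h x hx).ge)

theorem expect_const (p : PMF α) (c : ℝ≥0∞) : expect p (fun _ => c) = c := by
  simp [expect, ENNReal.tsum_mul_right]

theorem expect_mul_right (p : PMF α) (f : α → ℝ≥0∞) (c : ℝ≥0∞) :
    expect p (fun x => f x * c) = expect p f * c := by
  simp only [expect, ← mul_assoc, ENNReal.tsum_mul_right]

theorem expect_mul_left (p : PMF α) (f : α → ℝ≥0∞) (c : ℝ≥0∞) :
    expect p (fun x => c * f x) = c * expect p f := by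
  simp only [mul_comm c, expect_mul_right]

theorem expect_add (p : PMF α) (f g : α → ℝ≥0∞) :
    expect p (fun x => f x + g x) = expect p f + expect p g := by
  simp only [expect, mul_add, ENNReal.tsum_add]

theorem expect_le_const {p : PMF α} {f : α → ℝ≥0∞} {c : ℝ≥0∞} (h : ∀ x ∈ p.support, f x ≤ c) :
    expect p f ≤ c :=
  (expect_mono h).trans (expect_const p c).le

theorem toOuterMeasure_le_expect {p : PMF α} {s : Set α} {f : α → ℝ≥0∞}
    (h : ∀ x ∈ p.support, x ∈ s → 1 ≤ f x) : p.toOuterMeasure s ≤ expect p f := by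
  rw [PMF.toOuterMeasure_apply]
  refine ENNReal.tsum_le_tsum fun x => ?_
  by_cases hx : p x = 0
  · simp [Set.indicator, hx]
  by_cases hs : x ∈ s
  · rw [Set.indicator_of_mem hs]
    exact le_mul_of_one_le_right' (h x hx hs)
  · simp [hs]

theorem toOuterMeasure_eq_expect (p : PMF α) (s : Set α) :
    p.toOuterMeasure s = expect p (s.indicator 1) := by
  rw [PMF.toOuterMeasure_apply]
  refine tsum_congr fun x => ?_
  by_cases hs : x ∈ s <;> simp [hs]

theorem toOuterMeasure_mono_support {p : PMF α} {s t : Set α}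
    (h : ∀ x ∈ p.support, x ∈ s → x ∈ t) : p.toOuterMeasure s ≤ p.toOuterMeasure t := by
  rw [toOuterMeasure_eq_expect p t]
  exact toOuterMeasure_le_expect fun x hx hs => by simp [h x hx hs]

theorem toOuterMeasure_le_one (p : PMF α) (s : Set α) : p.toOuterMeasure s ≤ 1 := by
  rw [toOuterMeasure_eq_expect]
  exact expect_le_const fun x _ => by by_cases hx : x ∈ s <;> simp [hx]

end Expect

/-! ## Handling tokens -/

section Handle

variable {V : Type}

/-- The buffers after `t` is appended to the buffer of `u` towards `v`. -/
def Buffers.push (s : Buffers V) (u v : V) (t : Token V) : Buffers V :=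
  { s with
      outbox := Function.update s.outbox u
        (Function.update (s.outbox u) v (s.outbox u v ++ [t])) }

/-- The buffers after the walk of `t` has ended at `u`. -/
def Buffers.finish (s : Buffers V) (u : V) (t : Token V) : Buffers V :=
  { s with ended := Function.update s.ended u (s.ended u ++ [{ t with dest := some u }]) }

theorem Buffers.push_outbox (s : Buffers V) (u v u' v' : V) (t : Token V) :
    (s.push u v t).outbox u' v' =
      if u' = u ∧ v' = v then s.outbox u v ++ [t] else s.outbox u' v' := by
  by_cases hu : u' = u
  · subst hu
    by_cases hv : v' = v
    · subst hv
      simp [Buffers.push]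
    · simp [Buffers.push, hv]
  · simp [Buffers.push, hu]

theorem Buffers.finish_ended (s : Buffers V) (u u' : V) (t : Token V) :
    (s.finish u t).ended u' =
      if u' = u then s.ended u ++ [{ t with dest := some u }] else s.ended u' := by
  by_cases hu : u' = u
  · subst hu
    simp [Buffers.finish]
  · simp [Buffers.finish, hu]

theorem Buffers.push_ended (s : Buffers V) (u v : V) (t : Token V) :
    (s.push u v t).ended = s.ended := rfl

theorem Buffers.finish_outbox (s : Buffers V) (u : V) (t : Token V) :
    (s.finish u t).outbox = s.outbox := rfl

variable {P : Phase V} {rule : Rule V} {S : Snapshot V}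

theorem handle_of_le {x : V × Token V} (h : P.rwLength ≤ x.2.counter) (s : Buffers V) :
    handle P rule S x s = PMF.pure (s.finish x.1 x.2) := if_pos h

theorem handle_of_lt {x : V × Token V} (h : x.2.counter < P.rwLength) (s : Buffers V) :
    handle P rule S x s = (rule S x.1 x.2).map fun v => s.push x.1 v x.2 :=
  if_neg (not_le.2 h)

theorem mem_support_handle {x : V × Token V} {s s' : Buffers V}
    (hs : s' ∈ (handle P rule S x s).support) :
    (P.rwLength ≤ x.2.counter ∧ s' = s.finish x.1 x.2) ∨
      (x.2.counter < P.rwLength ∧ ∃ v ∈ (rule S x.1 x.2).support, s' = s.push x.1 v x.2) := by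
  rcases le_or_gt P.rwLength x.2.counter with h | h
  · rw [handle_of_le h] at hs
    exact Or.inl ⟨h, by simpa using hs⟩
  · rw [handle_of_lt h, PMF.mem_support_map_iff] at hs
    obtain ⟨v, hv, rfl⟩ := hs
    exact Or.inr ⟨h, v, hv, rfl⟩

/-- Supermartingale principle: `Φ` depends on the tokens still to be handled as well as on the
buffers, so a bound for a single draw, uniform in the past, propagates through the list whatever its
order. -/
theorem expect_handleAll_le (Φ : List (V × Token V) → Buffers V → ℝ≥0∞)
    (l : List (V × Token V))
    (h : ∀ x ∈ l, ∀ xs s, expect (handle P rule S x s) (Φ xs) ≤ Φ (x :: xs) s) (s : Buffers V) :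
    expect (handleAll P rule S l s) (Φ []) ≤ Φ l s := by
  induction l generalizing s with
  | nil => exact (expect_pure _ _).le
  | cons x xs ih =>
    rw [handleAll, expect_bind]
    exact (expect_mono fun s' _ => ih (fun y hy => h y (List.mem_cons_of_mem _ hy)) s').trans
      (h x List.mem_cons_self xs s)

/-- A token in a buffer was there before, or it has been handled and drawn into it. -/
theorem mem_outbox_handleAll {l : List (V × Token V)} {s s' : Buffers V}
    (hs : s' ∈ (handleAll P rule S l s).support) {u v : V} {t : Token V}
    (ht : t ∈ s'.outbox u v) :
    t ∈ s.outbox u v ∨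
      ((u, t) ∈ l ∧ t.counter < P.rwLength ∧ v ∈ (rule S u t).support) := by
  induction l generalizing s with
  | nil =>
    rw [handleAll, PMF.mem_support_pure_iff] at hs
    subst hs
    exact Or.inl ht
  | cons x xs ih =>
    rw [handleAll, PMF.mem_support_bind_iff] at hs
    obtain ⟨s₁, h₁, h₂⟩ := hs
    rcases ih h₂ with h | h
    · rcases mem_support_handle h₁ with ⟨_, rfl⟩ | ⟨hlt, y, hy, rfl⟩
      · exact Or.inl h
      · rw [Buffers.push_outbox] at h
        split_ifs at h with hc
        · obtain ⟨rfl, rfl⟩ := hc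
          rw [List.mem_append, List.mem_singleton] at h
          rcases h with h | rfl
          · exact Or.inl h
          · exact Or.inr ⟨List.mem_cons_self, hlt, hy⟩
        · exact Or.inl h
    · exact Or.inr ⟨List.mem_cons_of_mem _ h.1, h.2⟩

/-- Handling only appends at the tail, so waiting tokens keep their FIFO positions; the waiting-time
argument depends on this. -/
theorem outbox_prefix_handleAll {l : List (V × Token V)} {s s' : Buffers V}
    (hs : s' ∈ (handleAll P rule S l s).support) (u v : V) :
    s.outbox u v <+: s'.outbox u v := by
  induction l generalizing s with
  | nil =>
    rw [handleAll, PMF.mem_support_pure_iff] at hs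
    subst hs
    exact List.prefix_refl _
  | cons x xs ih =>
    rw [handleAll, PMF.mem_support_bind_iff] at hs
    obtain ⟨s₁, h₁, h₂⟩ := hs
    refine List.IsPrefix.trans ?_ (ih h₂)
    rcases mem_support_handle h₁ with ⟨_, rfl⟩ | ⟨_, y, _, rfl⟩
    · exact List.prefix_refl _
    · rw [Buffers.push_outbox]
      split_ifs with hc
      · obtain ⟨rfl, rfl⟩ := hc
        exact List.prefix_append _ _
      · exact List.prefix_refl _

theorem ended_prefix_handleAll {l : List (V × Token V)} {s s' : Buffers V}
    (hs : s' ∈ (handleAll P rule S l s).support) (u : V) : s.ended u <+: s'.ended u := by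
  induction l generalizing s with
  | nil =>
    rw [handleAll, PMF.mem_support_pure_iff] at hs
    subst hs
    exact List.prefix_refl _
  | cons x xs ih =>
    rw [handleAll, PMF.mem_support_bind_iff] at hs
    obtain ⟨s₁, h₁, h₂⟩ := hs
    refine List.IsPrefix.trans ?_ (ih h₂)
    rcases mem_support_handle h₁ with ⟨_, rfl⟩ | ⟨_, y, _, rfl⟩
    · rw [Buffers.finish_ended]
      split_ifs with hc
      · subst hc
        exact List.prefix_append _ _
      · exact List.prefix_refl _
    · exact List.prefix_refl _

/-- A handled token has ended or is in a buffer. -/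
theorem handled_handleAll {l : List (V × Token V)} {s s' : Buffers V}
    (hs : s' ∈ (handleAll P rule S l s).support) {u : V} {t : Token V} (ht : (u, t) ∈ l) :
    (P.rwLength ≤ t.counter ∧ { t with dest := some u } ∈ s'.ended u) ∨
      (t.counter < P.rwLength ∧ ∃ v ∈ (rule S u t).support, t ∈ s'.outbox u v) := by
  induction l generalizing s with
  | nil => simp at ht
  | cons x xs ih =>
    rw [handleAll, PMF.mem_support_bind_iff] at hs
    obtain ⟨s₁, h₁, h₂⟩ := hs
    rw [List.mem_cons] at ht
    rcases ht with rfl | ht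
    · rcases mem_support_handle h₁ with ⟨hle, rfl⟩ | ⟨hlt, y, hy, rfl⟩
      · refine Or.inl ⟨hle, (ended_prefix_handleAll h₂ u).subset ?_⟩
        simp [Buffers.finish_ended]
      · refine Or.inr ⟨hlt, y, hy, (outbox_prefix_handleAll h₂ u y).subset ?_⟩
        simp [Buffers.push_outbox]
    · exact ih h₂ ht

end Handle

/-! ## Executions -/

section Rounds

variable {V : Type} {P : Phase V}

theorem accepted_length_le (h : History V) (c : Config V) (S : Snapshot V) (u v : V) :
    (accepted P h c S u v).length ≤ if S.graph.Adj u v then P.cap else 0 := by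
  unfold accepted sent
  split_ifs <;> simp

theorem mem_accepted {h : History V} {c : Config V} {S : Snapshot V} {u v : V} {t : Token V}
    (ht : t ∈ accepted P h c S u v) {w : V × ℕ} (hw : t.origin = some w) :
    S.graph.Adj u v ∧ u ∉ P.byz ∧ t ∈ c.outbox u v := by
  unfold accepted at ht
  split_ifs at ht
  · simp at ht
  · have ht' := List.mem_of_mem_take ht
    unfold sent at ht'
    split_ifs at ht' with h₁ h₂
    · rw [List.mem_map] at ht'
      obtain ⟨t', _, rfl⟩ := ht'
      simp at hw
    · exact ⟨h₁, h₂, List.mem_of_mem_take ht'⟩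
    · simp at ht'

theorem mem_kept {c : Config V} {S : Snapshot V} {u v : V} {t : Token V}
    (ht : t ∈ kept P c S u v) : S.graph.Adj u v ∧ t ∈ c.outbox u v := by
  unfold kept at ht
  split_ifs at ht with h
  · exact ⟨h.1, List.mem_of_mem_drop ht⟩
  · simp at ht

theorem walksIn_cons (C : Finset V) {c : Config V} {h : History V} {w : V × ℕ} :
    WalksIn C (c :: h) w ↔
      (∀ u v, ∀ t ∈ c.outbox u v, t.origin = some w → u ∈ C ∧ v ∈ C) ∧ WalksIn C h w := by
  simp [WalksIn]

theorem mem_created {v : V} {t : Token V} (ht : t ∈ created P v) :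
    v ∉ P.byz ∧ ∃ i < P.init v, t = ⟨some (v, i), 0, [], none⟩ := by
  unfold created at ht
  split_ifs at ht with hv
  · simp only [List.mem_map, List.mem_range] at ht
    obtain ⟨i, hi, rfl⟩ := ht
    exact ⟨hv.2, i, hi, rfl⟩
  · simp at ht

theorem kept_length_le (c : Config V) (S : Snapshot V) (u v : V) :
    (kept P c S u v).length ≤ (c.outbox u v).length - P.cap := by
  unfold kept
  split_ifs <;> simp

end Rounds

section Execution

variable {V : Type} [Fintype V]

/-- The tokens of a family of lists, each with its node. -/
def tokenList (f : V → List (Token V)) : List (V × Token V) :=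
  (univ : Finset V).toList.flatMap fun v => (f v).map fun t => (v, t)

theorem mem_tokenList {f : V → List (Token V)} {v : V} {t : Token V} :
    (v, t) ∈ tokenList f ↔ t ∈ f v := by
  simp [tokenList]

variable {P : Phase V} {rule : Rule V}

theorem startLaw_eq : startLaw P rule =
    (handleAll P rule P.start (tokenList (created P)) ⟨fun _ _ => [], fun _ => []⟩).map
      fun s => [⟨P.start, fun _ _ => [], s.outbox, P.black, s.ended, s.ended⟩] := rfl

theorem walkRound_eq (h : History V) (c : Config V) : walkRound P rule h c =
    (handleAll P rule (P.adv.net h) (tokenList (received P h c (P.adv.net h)))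
      ⟨kept P c (P.adv.net h), c.ended⟩).map fun s =>
      { net := P.adv.net h
        moved := accepted P h c (P.adv.net h)
        outbox := s.outbox
        black := fun v u => c.black v u ∨ P.cap < (sent P h c (P.adv.net h) u v).length
        ended := s.ended
        back := s.ended } := rfl

theorem mem_support_startLaw {h : History V} (hh : h ∈ (startLaw P rule).support) :
    ∃ s ∈ (handleAll P rule P.start (tokenList (created P))
        ⟨fun _ _ => [], fun _ => []⟩).support,
      h = [⟨P.start, fun _ _ => [], s.outbox, P.black, s.ended, s.ended⟩] := by
  rw [startLaw_eq, PMF.mem_support_map_iff] at hh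
  obtain ⟨s, hs, rfl⟩ := hh
  exact ⟨s, hs, rfl⟩

theorem mem_support_walkRound {h : History V} {c c' : Config V}
    (hc : c' ∈ (walkRound P rule h c).support) :
    ∃ s ∈ (handleAll P rule (P.adv.net h) (tokenList (received P h c (P.adv.net h)))
        ⟨kept P c (P.adv.net h), c.ended⟩).support,
      c' = { net := P.adv.net h
             moved := accepted P h c (P.adv.net h)
             outbox := s.outbox
             black := fun v u => c.black v u ∨ P.cap < (sent P h c (P.adv.net h) u v).length
             ended := s.ended
             back := s.ended } := by
  rw [walkRound_eq, PMF.mem_support_map_iff] at hc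
  obtain ⟨s, hs, rfl⟩ := hc
  exact ⟨s, hs, rfl⟩

theorem length_of_mem_support {r : ℕ} {h : History V}
    (hh : h ∈ (execution P rule r).support) : h.length = r + 1 := by
  induction r generalizing h with
  | zero =>
    obtain ⟨s, _, rfl⟩ := mem_support_startLaw hh
    rfl
  | succ r ih =>
    rw [execution, PMF.mem_support_bind_iff] at hh
    obtain ⟨h₀, h₁, h₂⟩ := hh
    have hl := ih h₁
    match h₀, hl with
    | c :: h₀, hl =>
      simp only [nextRound] at h₂
      split_ifs at h₂
      · rw [PMF.mem_support_map_iff] at h₂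
        obtain ⟨c', _, rfl⟩ := h₂
        simp only [List.length_cons] at hl ⊢
        omega
      · rw [PMF.mem_support_pure_iff] at h₂
        subst h₂
        simp only [List.length_cons] at hl ⊢
        omega

theorem mem_support_nextRound {c : Config V} {h h' : History V}
    (hh : h' ∈ (nextRound P rule (c :: h)).support) :
    (h.length < P.half ∧ ∃ c' ∈ (walkRound P rule (c :: h) c).support, h' = c' :: c :: h) ∨
      (P.half ≤ h.length ∧ h' = returnRound P (c :: h) c :: c :: h) := by
  simp only [nextRound] at hh
  split_ifs at hh with hl
  · rw [PMF.mem_support_map_iff] at hh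
    obtain ⟨c', hc', rfl⟩ := hh
    exact Or.inl ⟨hl, c', hc', rfl⟩
  · rw [PMF.mem_support_pure_iff] at hh
    simp only [List.length_cons] at hl
    exact Or.inr ⟨by omega, hh⟩

theorem mem_support_execution_succ {r : ℕ} {h' : History V}
    (hh : h' ∈ (execution P rule (r + 1)).support) :
    ∃ c h, (c :: h) ∈ (execution P rule r).support ∧
      ((r < P.half ∧ ∃ c' ∈ (walkRound P rule (c :: h) c).support, h' = c' :: c :: h) ∨
        (P.half ≤ r ∧ h' = returnRound P (c :: h) c :: c :: h)) := by
  rw [execution, PMF.mem_support_bind_iff] at hh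
  obtain ⟨h₀, h₁, h₂⟩ := hh
  have hl := length_of_mem_support h₁
  match h₀, hl with
  | c :: h₀, hl =>
    obtain rfl : h₀.length = r := by simpa using hl
    exact ⟨c, h₀, h₁, mem_support_nextRound h₂⟩

theorem net_of_mem_support {r : ℕ} {h : History V} (hh : h ∈ (execution P rule r).support)
    {c : Config V} (hc : c ∈ h) : c.net = P.start ∨ ∃ h', c.net = P.adv.net h' := by
  induction r generalizing h with
  | zero =>
    obtain ⟨s, _, rfl⟩ := mem_support_startLaw hh
    rw [List.mem_singleton] at hc
    subst hc
    exact Or.inl rfl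
  | succ r ih =>
    obtain ⟨c₀, h₀, h₁, ⟨_, c', hc', rfl⟩ | ⟨_, rfl⟩⟩ := mem_support_execution_succ hh
    · rw [List.mem_cons] at hc
      rcases hc with rfl | hc
      · obtain ⟨s, _, rfl⟩ := mem_support_walkRound hc'
        exact Or.inr ⟨_, rfl⟩
      · exact ih h₁ hc
    · rw [List.mem_cons] at hc
      rcases hc with rfl | hc
      · exact Or.inr ⟨_, rfl⟩
      · exact ih h₁ hc

theorem exists_start_mem {r : ℕ} {h : History V} (hh : h ∈ (execution P rule r).support) :
    ∃ c ∈ h, c.net = P.start := by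
  induction r generalizing h with
  | zero =>
    obtain ⟨s, _, rfl⟩ := mem_support_startLaw hh
    exact ⟨_, List.mem_cons_self, rfl⟩
  | succ r ih =>
    obtain ⟨c₀, h₀, h₁, ⟨_, c', hc', rfl⟩ | ⟨_, rfl⟩⟩ := mem_support_execution_succ hh <;>
    · obtain ⟨c, hc, hn⟩ := ih h₁
      exact ⟨c, List.mem_cons_of_mem _ hc, hn⟩

theorem moved_length_le {r : ℕ} {h : History V} (hh : h ∈ (execution P rule r).support)
    {c : Config V} (hc : c ∈ h) (u v : V) :
    (c.moved u v).length ≤ if c.net.graph.Adj u v then P.cap else 0 := by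
  induction r generalizing h with
  | zero =>
    obtain ⟨s, _, rfl⟩ := mem_support_startLaw hh
    rw [List.mem_singleton] at hc
    subst hc
    exact Nat.zero_le _
  | succ r ih =>
    obtain ⟨c₀, h₀, h₁, ⟨_, c', hc', rfl⟩ | ⟨_, rfl⟩⟩ := mem_support_execution_succ hh
    · rw [List.mem_cons] at hc
      rcases hc with rfl | hc
      · obtain ⟨s, _, rfl⟩ := mem_support_walkRound hc'
        exact accepted_length_le _ _ _ _ _
      · exact ih h₁ hc
    · rw [List.mem_cons] at hc
      rcases hc with rfl | hc
      · exact Nat.zero_le _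
      · exact ih h₁ hc

/-- The adversary's order is a permutation, hence invisible to memberships, lengths, sums and
counts, which are all that is used below. -/
theorem perm_received (h : History V) (c : Config V) (S : Snapshot V) {v : V} (hv : v ∉ P.byz) :
    (received P h c S v).Perm ((univ : Finset V).toList.flatMap fun u =>
      (accepted P h c S u v).map fun t =>
        { t with counter := t.counter + 1, trail := (u, h.length) :: t.trail }) := by
  unfold received
  rw [if_neg hv]
  exact P.adv.order_perm _ _ _

theorem mem_received {h : History V} {c : Config V} {S : Snapshot V} {v : V} {t : Token V} :
    t ∈ received P h c S v ↔ v ∉ P.byz ∧ ∃ u, ∃ t₀ ∈ accepted P h c S u v,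
      t = { t₀ with counter := t₀.counter + 1, trail := (u, h.length) :: t₀.trail } := by
  by_cases hv : v ∈ P.byz
  · simp [received, hv]
  · rw [(perm_received h c S hv).mem_iff]
    simp [hv, eq_comm]

theorem received_length_le (h : History V) (c : Config V) (S : Snapshot V) (v : V) :
    (received P h c S v).length ≤ (nbrs S v).card * P.cap := by
  by_cases hv : v ∈ P.byz
  · simp [received, hv]
  · rw [(perm_received h c S hv).length_eq, List.length_flatMap, Finset.sum_map_toList]
    simp only [List.length_map]
    calc ∑ u, (accepted P h c S u v).length
        ≤ ∑ u, if S.graph.Adj u v then P.cap else 0 :=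
          Finset.sum_le_sum fun u _ => accepted_length_le _ _ _ _ _
      _ = (nbrs S v).card * P.cap := by
          rw [← Finset.sum_filter, Finset.sum_const, smul_eq_mul]
          congr 2
          ext u
          simp [nbrs, SimpleGraph.adj_comm]

theorem mem_support_pick {S : Snapshot V} {u v : V} (hv : v ∈ (pick S u).support) :
    S.graph.Adj u v ∨ (nbrs S u = ∅ ∧ v = u) := by
  unfold pick at hv
  split_ifs at hv with h
  · rw [PMF.mem_support_uniformOfFinset_iff] at hv
    exact Or.inl (by simpa [nbrs] using hv)
  · rw [PMF.mem_support_pure_iff] at hv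
    exact Or.inr ⟨Finset.not_nonempty_iff_eq_empty.1 h, hv⟩

/-! ## Crossings and escapes -/

section Boundary

variable (C : Finset V) {Δ : ℕ}

theorem adj_iff_mem_nbrs {S : Snapshot V} {u v : V} : v ∈ nbrs S u ↔ S.graph.Adj u v := by
  simp [nbrs]

/-- Counted from outside: each present node outside `C` has at most `Δ` links, of capacity `B` each;
an absent node has none. -/
theorem sum_boundary_le (S : Snapshot V) (hd : ∀ u, (nbrs S u).card ≤ Δ) (B : ℕ)
    (g : V → V → ℕ) (hg : ∀ u v, g u v ≤ if S.graph.Adj u v then B else 0) :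
    ∑ u ∈ C, ∑ v ∈ Cᶜ, g u v ≤ (S.alive \ C).card * (Δ * B) := by
  rw [Finset.sum_comm]
  have hin : ∀ v, ∑ u ∈ C, g u v ≤ if v ∈ S.alive then Δ * B else 0 := by
    intro v
    have h₁ : ∑ u ∈ C, g u v ≤ ∑ u, if S.graph.Adj u v then B else 0 :=
      (Finset.sum_le_sum fun u _ => hg u v).trans
        (Finset.sum_le_sum_of_subset (Finset.subset_univ C))
    have h₂ : (∑ u, if S.graph.Adj u v then B else 0) = (nbrs S v).card * B := by
      rw [← Finset.sum_filter, Finset.sum_const, smul_eq_mul]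
      congr 2
      ext u
      simp [nbrs, SimpleGraph.adj_comm]
    rw [h₂] at h₁
    split_ifs with hv
    · exact h₁.trans (Nat.mul_le_mul_right _ (hd v))
    · have : nbrs S v = ∅ := by
        ext u
        simp only [adj_iff_mem_nbrs, Finset.notMem_empty, iff_false]
        exact fun ha => hv (S.adj_alive _ _ ha)
      simpa [this] using h₁
  calc ∑ v ∈ Cᶜ, ∑ u ∈ C, g u v ≤ ∑ v ∈ Cᶜ, if v ∈ S.alive then Δ * B else 0 :=
        Finset.sum_le_sum fun v _ => hin v
    _ = (S.alive \ C).card * (Δ * B) := by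
        rw [← Finset.sum_filter, Finset.sum_const, smul_eq_mul]
        congr 2
        ext v
        simp [and_comm]

/-- The nodes of `C` with a neighbour outside `C`. -/
def boundary (S : Snapshot V) : Finset V := C.filter fun u => ∃ v ∉ C, S.graph.Adj u v

theorem card_boundary_le (S : Snapshot V) (hd : ∀ u, (nbrs S u).card ≤ Δ) :
    (boundary C S).card ≤ (S.alive \ C).card * Δ := by
  refine le_trans (Finset.card_le_card ?_)
    (Finset.card_biUnion_le_card_mul (S.alive \ C) (nbrs S) Δ fun v _ => hd v)
  intro u hu
  obtain ⟨_, v, hv, ha⟩ := Finset.mem_filter.1 hu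
  exact Finset.mem_biUnion.2 ⟨v, Finset.mem_sdiff.2 ⟨S.adj_alive _ _ ha.symm, hv⟩,
    adj_iff_mem_nbrs.2 ha.symm⟩

theorem crossings_le (hd₀ : ∀ u, (nbrs P.start u).card ≤ Δ)
    (hd : ∀ h u, (nbrs (P.adv.net h) u).card ≤ Δ) {r : ℕ} {h : History V}
    (hh : h ∈ (execution P rule r).support) :
    crossings C h ≤ (h.map fun c => (c.net.alive \ C).card * (Δ * (2 * P.cap))).sum := by
  refine List.sum_le_sum fun c hc => sum_boundary_le C c.net ?_ _ _ fun u v => ?_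
  · rcases net_of_mem_support hh hc with hn | ⟨h', hn⟩ <;> rw [hn]
    · exact hd₀
    · exact hd h'
  · have h₁ := moved_length_le hh hc u v
    have h₂ := moved_length_le hh hc v u
    rw [SimpleGraph.adj_comm] at h₂
    split_ifs at h₁ h₂ ⊢ <;> omega

variable {C}

/-- A token that walks only in `C` so far and leaves `C` in the next round is received by a node
of the boundary. -/
theorem exists_received_of_escape (hsupp : ∀ S u t, (rule S u t).support ⊆ (pick S u).support)
    {c c' : Config V} {h : History V} {w : V × ℕ}
    (hc : c' ∈ (walkRound P rule (c :: h) c).support) (hw : WalksIn C (c :: h) w)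
    (hw' : ¬ WalksIn C (c' :: c :: h) w) :
    ∃ u ∈ boundary C (P.adv.net (c :: h)),
      ∃ t ∈ received P (c :: h) c (P.adv.net (c :: h)) u, t.origin = some w := by
  obtain ⟨s, hs, rfl⟩ := mem_support_walkRound hc
  rw [walksIn_cons, and_iff_left hw] at hw'
  push Not at hw'
  obtain ⟨u, v, t, ht, hto, huv⟩ := hw'
  have hw₀ := ((walksIn_cons C).1 hw).1
  rcases mem_outbox_handleAll hs ht with hk | ⟨hr, _, hv⟩
  · obtain ⟨h₁, h₂⟩ := hw₀ u v t (mem_kept hk).2 hto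
    exact absurd h₂ (huv h₁)
  · have hr := mem_tokenList.1 hr
    obtain ⟨_, z, t₀, ht₀, rfl⟩ := mem_received.1 hr
    have hu : u ∈ C := (hw₀ z u t₀ (mem_accepted ht₀ hto).2.2 hto).2
    refine ⟨u, Finset.mem_filter.2 ⟨hu, v, huv hu, ?_⟩, _, hr, hto⟩
    rcases mem_support_pick (hsupp _ _ _ hv) with ha | ⟨_, rfl⟩
    · exact ha
    · exact absurd hu (huv hu)

/-- A token is charged to the round in which it first draws a step out of `C`. At that moment a
boundary node handles it, as one of at most `Δ * cap` received tokens, or as one of at most `T`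
created ones at the start. No probability enters. -/
theorem card_escaped_le (hsupp : ∀ S u t, (rule S u t).support ⊆ (pick S u).support)
    (hd₀ : ∀ u, (nbrs P.start u).card ≤ Δ)
    (hd : ∀ h u, (nbrs (P.adv.net h) u).card ≤ Δ) {T : ℕ} (hT : ∀ v, v ∉ P.byz → P.init v ≤ T)
    {r : ℕ} {h : History V} (hh : h ∈ (execution P rule r).support) :
    ((P.tokens C).filter fun w => ¬ WalksIn C h w).card ≤
      (h.map fun c => (c.net.alive \ C).card * (Δ * (Δ * P.cap + T))).sum := by
  induction r generalizing h with
  | zero =>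
    obtain ⟨s, hs, rfl⟩ := mem_support_startLaw hh
    simp only [List.map_cons, List.map_nil, List.sum_cons, List.sum_nil, add_zero]
    have hsub : ((P.tokens C).filter fun w => ¬ WalksIn C
        [⟨P.start, fun _ _ => [], s.outbox, P.black, s.ended, s.ended⟩] w) ⊆
        ((boundary C P.start).filter (· ∉ P.byz)).biUnion fun u =>
          (range (P.init u)).image fun i => (u, i) := by
      intro w hw
      obtain ⟨hwC, hw⟩ := Finset.mem_filter.1 hw
      simp only [WalksIn, List.mem_singleton, forall_eq] at hw
      push Not at hw
      obtain ⟨u, v, t, ht, hto, huv⟩ := hw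
      rcases mem_outbox_handleAll hs ht with hk | ⟨hr, _, hv⟩
      · simp at hk
      · obtain ⟨hb, i, hi, rfl⟩ := mem_created (mem_tokenList.1 hr)
        obtain rfl : (u, i) = w := by simpa using hto
        have hu : u ∈ C := by
          obtain ⟨v', hv', hm⟩ := Finset.mem_biUnion.1 hwC
          obtain ⟨j, _, hj⟩ := Finset.mem_image.1 hm
          obtain ⟨rfl, _⟩ := Prod.mk.inj hj
          exact hv'
        refine Finset.mem_biUnion.2 ⟨u, Finset.mem_filter.2 ⟨Finset.mem_filter.2
          ⟨hu, v, huv hu, ?_⟩, hb⟩, Finset.mem_image.2 ⟨i, Finset.mem_range.2 hi, rfl⟩⟩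
        rcases mem_support_pick (hsupp _ _ _ hv) with ha | ⟨_, rfl⟩
        · exact ha
        · exact absurd hu (huv hu)
    refine (Finset.card_le_card hsub).trans ((Finset.card_biUnion_le_card_mul _ _ T
      fun u hu => ?_).trans ?_)
    · exact Finset.card_image_le.trans ((Finset.card_range _).le.trans
        (hT u (Finset.mem_filter.1 hu).2))
    · calc _ ≤ (boundary C P.start).card * T :=
            Nat.mul_le_mul_right _ (Finset.card_filter_le _ _)
        _ ≤ (P.start.alive \ C).card * Δ * T :=
            Nat.mul_le_mul_right _ (card_boundary_le C _ hd₀)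
        _ ≤ _ := by
            rw [mul_assoc]
            gcongr
            omega
  | succ r ih =>
    obtain ⟨c, h₀, h₁, ⟨_, c', hc', rfl⟩ | ⟨_, rfl⟩⟩ := mem_support_execution_succ hh
    · have ih := ih h₁
      set S := P.adv.net (c :: h₀) with hS
      rw [List.map_cons, List.sum_cons, add_comm]
      have hn : c'.net = S := by
        obtain ⟨s, _, rfl⟩ := mem_support_walkRound hc'
        rfl
      rw [hn]
      have hsub : ((P.tokens C).filter fun w => ¬ WalksIn C (c' :: c :: h₀) w) ⊆
          ((P.tokens C).filter fun w => ¬ WalksIn C (c :: h₀) w) ∪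
          ((boundary C S).biUnion fun u =>
            ((received P (c :: h₀) c S u).filterMap Token.origin).toFinset) := by
        intro w hw
        obtain ⟨hwC, hw⟩ := Finset.mem_filter.1 hw
        by_cases hw₀ : WalksIn C (c :: h₀) w
        · obtain ⟨u, hu, t, ht, hto⟩ := exists_received_of_escape hsupp hc' hw₀ hw
          refine Finset.mem_union_right _ (Finset.mem_biUnion.2 ⟨u, hu, ?_⟩)
          rw [List.mem_toFinset, List.mem_filterMap]
          exact ⟨t, ht, hto⟩
        · exact Finset.mem_union_left _ (Finset.mem_filter.2 ⟨hwC, hw₀⟩)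
      refine (Finset.card_le_card hsub).trans ((Finset.card_union_le _ _).trans ?_)
      gcongr
      refine (Finset.card_biUnion_le_card_mul _ _ (Δ * P.cap) fun u _ => ?_).trans ?_
      · refine (List.toFinset_card_le _).trans ((List.length_filterMap_le _ _).trans ?_)
        exact (received_length_le _ _ _ _).trans (Nat.mul_le_mul_right _ (hd _ u))
      · calc _ ≤ (S.alive \ C).card * Δ * (Δ * P.cap) :=
              Nat.mul_le_mul_right _ (card_boundary_le C _ (hd _))
          _ ≤ _ := by
              rw [mul_assoc]
              gcongr
              omega
    · have ih := ih h₁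
      rw [List.map_cons, List.sum_cons]
      refine le_trans (Finset.card_le_card ?_) (ih.trans (Nat.le_add_left _ _))
      refine Finset.monotone_filter_right _ fun w _ hw hw₀ => hw ?_
      exact (walksIn_cons C).2 ⟨((walksIn_cons C).1 hw₀).1, hw₀⟩

/-- The nodes outside the core that are ever present are few. -/
theorem card_alive_sdiff_le {K : ℕ} {h : History V}
    (hh : h ∈ (execution P rule (2 * P.half)).support)
    (hsize : (P.start.alive \ C).card ≤ K * (P.byzStart.card + (churned h).card))
    {c : Config V} (hc : c ∈ h) :
    (c.net.alive \ C).card ≤ (2 * K + 1) * ((P.byzEnd h).card + (churned h).card) := by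
  obtain ⟨c₀, hc₀, hn₀⟩ := exists_start_mem hh
  have h₁ : c.net.alive \ C ⊆ (P.start.alive \ C) ∪ churned h := by
    intro v hv
    obtain ⟨hv, hvC⟩ := Finset.mem_sdiff.1 hv
    by_cases hs : v ∈ P.start.alive
    · exact Finset.mem_union_left _ (Finset.mem_sdiff.2 ⟨hs, hvC⟩)
    · refine Finset.mem_union_right _ (Finset.mem_filter.2 ⟨Finset.mem_univ v,
        ⟨c, hc, hv⟩, ⟨c₀, hc₀, ?_⟩⟩)
      rwa [hn₀]
  -- A Byzantine node of the start that is absent at the end has left, hence is churned; this trades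
  -- the initial Byzantine count for the final one, counting churn again.
  have h₂ : P.byzStart ⊆ P.byzEnd h ∪ churned h := by
    intro v hv
    obtain ⟨hvb, hva⟩ := Finset.mem_inter.1 hv
    match h, hc, hc₀ with
    | e :: h, hc, hc₀ =>
      by_cases he : v ∈ e.net.alive
      · exact Finset.mem_union_left _ (Finset.mem_inter.2 ⟨hvb, he⟩)
      · exact Finset.mem_union_right _ (Finset.mem_filter.2 ⟨Finset.mem_univ v,
          ⟨c₀, hc₀, by rwa [hn₀]⟩, ⟨e, List.mem_cons_self, he⟩⟩)
  have h₃ := (Finset.card_le_card h₁).trans (Finset.card_union_le _ _)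
  have h₄ := (Finset.card_le_card h₂).trans (Finset.card_union_le _ _)
  nlinarith [Nat.mul_le_mul_left K h₄, Nat.zero_le (K * (P.byzEnd h).card)]

end Boundary

end Execution

/-! ## Following a token -/

section Track

variable {V : Type}

/-- What a core with static links provides for the tokens that walk in it. -/
structure StaticCore (P : Phase V) (C : Finset V) : Prop where
  honest : Disjoint C P.byz
  alive_start : C ⊆ P.start.alive
  static : ∀ h, ∀ u ∈ C, ∀ v ∈ C, (P.adv.net h).graph.Adj u v ↔ P.start.graph.Adj u v
  exists_adj : ∀ u ∈ C, ∃ v ∈ C, P.start.graph.Adj u v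

theorem StaticCore.notMem_byz {P : Phase V} {C : Finset V} (hC : StaticCore P C) {u : V}
    (hu : u ∈ C) : u ∉ P.byz := Finset.disjoint_left.1 hC.honest hu

/-- The recorded trail leads from `u` back to `src` inside `C`, along initial links, in rounds that
decrease from at most `r` to at least `1`. -/
def TrailOK (P : Phase V) (C : Finset V) (src : V) : V → ℕ → List (V × ℕ) → Prop
  | u, _, [] => u = src
  | u, r, x :: l => x.1 ∈ C ∧ P.start.graph.Adj u x.1 ∧ 1 ≤ x.2 ∧ x.2 ≤ r ∧
      TrailOK P C src x.1 (x.2 - 1) l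

theorem TrailOK.mono {P : Phase V} {C : Finset V} {src u : V} {r r' : ℕ} {l : List (V × ℕ)}
    (h : TrailOK P C src u r l) (hr : r ≤ r') : TrailOK P C src u r' l := by
  cases l with
  | nil => exact h
  | cons x l => exact ⟨h.1, h.2.1, h.2.2.1, h.2.2.2.1.trans hr, h.2.2.2.2⟩

/-- At the end of round `r` the token `w` has ended in `C`, or it waits at a link of `C`, having
made a step in at least every second round. -/
def Located (P : Phase V) (C : Finset V) (w : V × ℕ) (r : ℕ) (s : Buffers V) : Prop :=
  (∃ u ∈ C, ∃ t ∈ s.ended u, t.origin = some w ∧ t.counter = P.rwLength ∧ t.dest = some u ∧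
    TrailOK P C w.1 u r t.trail) ∨
  (∃ u ∈ C, ∃ v ∈ C, P.start.graph.Adj u v ∧ ∃ t ∈ s.outbox u v, t.origin = some w ∧
    t.counter < P.rwLength ∧ TrailOK P C w.1 u r t.trail ∧
    (r ≤ 2 * t.counter ∨ (r ≤ 2 * t.counter + 1 ∧ t ∈ (s.outbox u v).take P.cap)))

/-- All buffers inside `C` hold at most `2 * cap` tokens. -/
def QueueBounded (C : Finset V) (cap : ℕ) (h : History V) : Prop :=
  ∀ c ∈ h, ∀ u ∈ C, ∀ v ∈ C, (c.outbox u v).length ≤ 2 * cap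

theorem mem_tokens_iff {P : Phase V} {C : Finset V} {w : V × ℕ} : w ∈ P.tokens C ↔ w.1 ∈ C ∧ w.2 < P.init w.1 := by
  obtain ⟨v, i⟩ := w
  simp only [Phase.tokens, Finset.mem_biUnion, Finset.mem_image, Finset.mem_range, Prod.mk.injEq]
  constructor
  · rintro ⟨v', hv', j, hj, rfl, rfl⟩
    exact ⟨hv', hj⟩
  · rintro ⟨hv, hi⟩
    exact ⟨v, hv, i, hi, rfl, rfl⟩

theorem QueueBounded.mono {C : Finset V} {cap : ℕ} {h h' : History V} (hq : QueueBounded C cap h)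
    (hs : h' ⊆ h) : QueueBounded C cap h' := fun c hc => hq c (hs hc)

theorem WalksIn.mono {C : Finset V} {h h' : History V} {w : V × ℕ} (hw : WalksIn C h w)
    (hs : h' ⊆ h) : WalksIn C h' w := fun c hc => hw c (hs hc)

variable [Fintype V] {P : Phase V} {rule : Rule V} {C : Finset V}

/-- The fallback of `pick`, which keeps the token in place at a node without neighbours, never
occurs in the core. -/
theorem pick_adj (hC : StaticCore P C) {S : Snapshot V}
    (hS : ∀ u ∈ C, ∀ v ∈ C, S.graph.Adj u v ↔ P.start.graph.Adj u v) {u v : V} (hu : u ∈ C)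
    (hv : v ∈ (pick S u).support) : S.graph.Adj u v := by
  rcases mem_support_pick hv with h | ⟨h, _⟩
  · exact h
  · obtain ⟨x, hx, ha⟩ := hC.exists_adj u hu
    have := adj_iff_mem_nbrs.2 ((hS u hu x hx).2 ha)
    simp [h] at this

theorem located_of_handled (hsupp : ∀ S u t, (rule S u t).support ⊆ (pick S u).support)
    (hC : StaticCore P C) {S : Snapshot V}
    (hS : ∀ u ∈ C, ∀ v ∈ C, S.graph.Adj u v ↔ P.start.graph.Adj u v)
    {l : List (V × Token V)} {s s' : Buffers V} {w : V × ℕ} {r : ℕ}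
    (hs : s' ∈ (handleAll P rule S l s).support)
    (hout : ∀ u v, ∀ t ∈ s'.outbox u v, t.origin = some w → u ∈ C ∧ v ∈ C)
    {u : V} {t : Token V} (ht : (u, t) ∈ l) (hu : u ∈ C) (hto : t.origin = some w)
    (htc : t.counter ≤ P.rwLength) (htr : TrailOK P C w.1 u r t.trail) (hr : r ≤ 2 * t.counter) :
    Located P C w r s' := by
  rcases handled_handleAll hs ht with ⟨hle, he⟩ | ⟨hlt, v, hv, hvo⟩
  · exact Or.inl ⟨u, hu, _, he, hto, le_antisymm htc hle, rfl, htr⟩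
  · have hvC := (hout u v t hvo hto).2
    exact Or.inr ⟨u, hu, v, hvC, (hS u hu v hvC).1 (pick_adj hC hS hu (hsupp _ _ _ hv)), t, hvo,
      hto, hlt, htr, Or.inl hr⟩

/-- Honest nodes never send more than `cap` tokens over a link, so blacklisting hits Byzantine nodes
only and core links stay usable. -/
theorem black_byz_of_mem_support {r : ℕ} {h : History V}
    (hh : h ∈ (execution P rule r).support) {c : Config V} (hc : c ∈ h) {u v : V}
    (hb : c.black v u) : u ∈ P.byz := by
  induction r generalizing h c with
  | zero =>
    obtain ⟨s, _, rfl⟩ := mem_support_startLaw hh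
    rw [List.mem_singleton] at hc
    subst hc
    exact P.black_byz _ _ hb
  | succ r ih =>
    obtain ⟨c₀, h₀, h₁, ⟨_, c', hc', rfl⟩ | ⟨_, rfl⟩⟩ := mem_support_execution_succ hh
    · rw [List.mem_cons] at hc
      rcases hc with rfl | hc
      · obtain ⟨s, _, rfl⟩ := mem_support_walkRound hc'
        rcases hb with hb | hb
        · exact ih h₁ List.mem_cons_self hb
        · by_contra hu
          have hb' : P.cap < (sent P (c₀ :: h₀) c₀ (P.adv.net (c₀ :: h₀)) u v).length := hb
          unfold sent at hb'
          split_ifs at hb' <;> simp at hb'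
      · exact ih h₁ hc hb
    · rw [List.mem_cons] at hc
      rcases hc with rfl | hc
      · exact ih h₁ List.mem_cons_self hb
      · exact ih h₁ hc hb

/-- A token that walks only in `C` makes a step at least every second round, as long as the buffers
are bounded. -/
theorem located_of_mem_support (hsupp : ∀ S u t, (rule S u t).support ⊆ (pick S u).support)
    (hC : StaticCore P C) {w : V × ℕ} (hw : w ∈ P.tokens C) {r : ℕ} (hr : r ≤ P.half)
    {c : Config V} {h : History V} (hh : (c :: h) ∈ (execution P rule r).support)
    (hwalk : WalksIn C (c :: h) w) (hq : QueueBounded C P.cap (c :: h)) :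
    Located P C w r ⟨c.outbox, c.ended⟩ := by
  induction r generalizing c h with
  | zero =>
    obtain ⟨s, hs, he⟩ := mem_support_startLaw hh
    obtain ⟨rfl, rfl⟩ := List.cons.inj he
    obtain ⟨hwC, hwi⟩ := mem_tokens_iff.1 hw
    refine located_of_handled hsupp hC (S := P.start) (fun _ _ _ _ => Iff.rfl) hs
      ((walksIn_cons C).1 hwalk).1 (u := w.1) (t := ⟨some w, 0, [], none⟩)
      (mem_tokenList.2 ?_) hwC rfl (Nat.zero_le _) rfl le_rfl
    unfold created
    rw [if_pos ⟨hC.alive_start hwC, hC.notMem_byz hwC⟩, List.mem_map]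
    exact ⟨w.2, List.mem_range.2 hwi, rfl⟩
  | succ r ih =>
    obtain ⟨c₀, h₀, h₁, ⟨_, c', hc', he⟩ | ⟨hle, _⟩⟩ := mem_support_execution_succ hh
    swap
    · omega
    obtain ⟨rfl, rfl⟩ := List.cons.inj he
    have hlen := length_of_mem_support h₁
    have hwalk' := (walksIn_cons C).1 hwalk
    have hblack := fun u v => black_byz_of_mem_support h₁ (c := c₀) List.mem_cons_self
      (u := u) (v := v)
    have ih := ih (by omega) h₁ hwalk'.2 fun c hc => hq c (List.mem_cons_of_mem _ hc)
    have hq₀ := hq c₀ (by simp)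
    obtain ⟨s, hs, rfl⟩ := mem_support_walkRound hc'
    set S := P.adv.net (c₀ :: h₀) with hSdef
    have hS := hC.static (c₀ :: h₀)
    rcases ih with ⟨u, hu, t, ht, hto, htc, htd, htr⟩ | ⟨u, hu, v, hv, ha, t, ht, hto, htc, htr, htm⟩
    · exact Or.inl ⟨u, hu, t, (ended_prefix_handleAll hs u).subset ht, hto, htc, htd,
        htr.mono (Nat.le_succ r)⟩
    · have haS : S.graph.Adj u v := (hS u hu v hv).2 ha
      by_cases htake : t ∈ (c₀.outbox u v).take P.cap
      · have hacc : t ∈ accepted P (c₀ :: h₀) c₀ S u v := by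
          unfold accepted sent
          rw [if_neg fun hb => hC.notMem_byz hu (hblack _ _ hb), if_pos haS,
            if_neg (hC.notMem_byz hu), List.take_take, min_self]
          exact htake
        have hrec := mem_received.2 ⟨hC.notMem_byz hv, u, t, hacc, rfl⟩
        refine located_of_handled hsupp hC hS hs hwalk'.1 (mem_tokenList.2 hrec) hv hto
          (Nat.succ_le_of_lt htc) ?_ ?_
        -- The stamp on the trail is the length of the history, which is `r + 1`, the index of the
        -- round being executed.
        · rw [hlen]
          exact ⟨hu, ha.symm, Nat.succ_pos r, le_rfl, htr⟩
        · change r + 1 ≤ 2 * (t.counter + 1)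
          omega
      -- A token that is not sent has no arrears, since arrears are allowed only among the first
      -- `cap` positions. At most `cap` tokens are left after sending and arrivals queue behind
      -- them, so the token is now among the first `cap` and moves in the next round.
      · have htm : r ≤ 2 * t.counter := htm.resolve_right fun h => htake h.2
        have hdrop : t ∈ (c₀.outbox u v).drop P.cap := by
          replace ht : t ∈ c₀.outbox u v := ht
          rw [← List.take_append_drop P.cap (c₀.outbox u v), List.mem_append] at ht
          exact ht.resolve_left htake
        have hkept : kept P c₀ S u v = (c₀.outbox u v).drop P.cap :=
          if_pos ⟨haS, hC.notMem_byz hu⟩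
        have hpre : (c₀.outbox u v).drop P.cap <+: s.outbox u v :=
          hkept ▸ outbox_prefix_handleAll hs u v
        refine Or.inr ⟨u, hu, v, hv, ha, t, hpre.subset hdrop, hto, htc,
          htr.mono (Nat.le_succ r), Or.inr ⟨by omega, ?_⟩⟩
        obtain ⟨l, hl⟩ := hpre
        have hlen' : ((c₀.outbox u v).drop P.cap).length ≤ P.cap := by
          have := hq₀ u hu v hv
          rw [List.length_drop]
          omega
        change t ∈ (s.outbox u v).take P.cap
        rw [← hl, List.take_append, List.take_of_length_le hlen']
        exact List.mem_append_left _ hdrop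

theorem drop_mem_support {r k : ℕ} {h : History V}
    (hh : h ∈ (execution P rule (r + k)).support) : h.drop k ∈ (execution P rule r).support := by
  induction k generalizing h with
  | zero => exact hh
  | succ k ih =>
    obtain ⟨c, h₀, h₁, ⟨_, c', _, rfl⟩ | ⟨_, rfl⟩⟩ := mem_support_execution_succ hh <;>
    exact ih h₁

theorem configAt_eq_head_drop {r k : ℕ} {h : History V}
    (hh : h ∈ (execution P rule (r + k)).support) : configAt h r = (h.drop k).head? := by
  have hl := length_of_mem_support hh
  rw [configAt, List.getElem?_reverse (by omega), List.head?_drop]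
  congr 1
  omega

theorem ended_subset_head {r : ℕ} {c e : Config V} {h : History V}
    (hh : (e :: h) ∈ (execution P rule r).support) (hc : c ∈ e :: h) (u : V) :
    c.ended u ⊆ e.ended u := by
  induction r generalizing e h with
  | zero =>
    obtain ⟨s, _, he⟩ := mem_support_startLaw hh
    rw [he, List.mem_singleton] at hc
    rw [hc, (List.cons.inj he).1]
    exact List.Subset.refl _
  | succ r ih =>
    rw [List.mem_cons] at hc
    rcases hc with rfl | hc
    · exact List.Subset.refl _
    obtain ⟨c₀, h₀, h₁, ⟨_, c', hc', he⟩ | ⟨_, he⟩⟩ := mem_support_execution_succ hh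
    · obtain ⟨rfl, rfl⟩ := List.cons.inj he
      obtain ⟨s, hs, rfl⟩ := mem_support_walkRound hc'
      exact fun t ht => (ended_prefix_handleAll hs u).subset (ih h₁ hc ht)
    · obtain ⟨rfl, rfl⟩ := List.cons.inj he
      exact fun t ht => ih h₁ hc ht

theorem back_eq_ended {r : ℕ} (hr : r ≤ P.half) {c : Config V} {h : History V}
    (hh : (c :: h) ∈ (execution P rule r).support) : c.back = c.ended := by
  cases r with
  | zero =>
    obtain ⟨s, _, he⟩ := mem_support_startLaw hh
    obtain ⟨rfl, rfl⟩ := List.cons.inj he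
    rfl
  | succ r =>
    obtain ⟨c₀, h₀, h₁, ⟨_, c', hc', he⟩ | ⟨hle, _⟩⟩ := mem_support_execution_succ hh
    · obtain ⟨rfl, rfl⟩ := List.cons.inj he
      obtain ⟨s, _, rfl⟩ := mem_support_walkRound hc'
      rfl
    · omega

/-- A verified token with a trail inside `C` retraces its trail. -/
theorem retraces (hC : StaticCore P C) {w : V × ℕ} {k : ℕ} (hk : k ≤ P.half) {h : History V}
    (hh : h ∈ (execution P rule (P.half + k)).support) {e : Config V}
    (he : (h.drop k).head? = some e) {u : V} (hu : u ∈ C) {t : Token V} (ht : t ∈ e.ended u)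
    (hto : t.origin = some w) (htd : t.dest = some u) (htr : TrailOK P C w.1 u P.half t.trail) :
    ∃ c, h.head? = some c ∧ ∃ u' ∈ C, ∃ t' ∈ c.back u', t'.origin = some w ∧ t'.dest = some u ∧
      TrailOK P C w.1 u' (P.half - k) t'.trail := by
  induction k generalizing h with
  | zero =>
    match h, he with
    | c :: h, he =>
      obtain rfl : c = e := by simpa using he
      refine ⟨c, rfl, u, hu, t, ?_, hto, htd, htr⟩
      rw [back_eq_ended le_rfl hh]
      exact ht
  | succ k ih =>
    obtain ⟨c₀, h₀, h₁, ⟨hlt, _⟩ | ⟨_, rfl⟩⟩ := mem_support_execution_succ (r := P.half + k) hh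
    · omega
    obtain ⟨c, hc, z, hz, t', ht', hto', htd', htr'⟩ := ih (by omega) h₁ (by simpa using he)
    obtain rfl : c₀ = c := by simpa using hc
    have hlen : (c₀ :: h₀).length = P.half + k + 1 := length_of_mem_support h₁
    refine ⟨_, rfl, ?_⟩
    -- Histories contain the initial configuration, hence the shift by one: this round of the way
    -- back undoes round `half - k` of the walk stage.
    have hs : 2 * P.half + 1 - (c₀ :: h₀).length = P.half - k := by omega
    have hS := hC.static (c₀ :: h₀)
    by_cases hx : ∃ y, (P.adv.net (c₀ :: h₀)).graph.Adj z y ∧ t'.trail.head? = some (y, P.half - k)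
    · obtain ⟨y, ha, hy⟩ := hx
      match htl : t'.trail with
      | [] => simp [htl] at hy
      | x :: l =>
        rw [htl] at hy htr'
        obtain rfl : x = (y, P.half - k) := by simpa using hy
        obtain ⟨hyC, -, -, -, hrest⟩ := htr'
        refine ⟨y, hyC, { t' with trail := l }, ?_, hto', htd', ?_⟩
        · simp only [returnRound, if_neg (hC.notMem_byz hyC), List.mem_append, List.mem_flatMap]
          refine Or.inr ⟨z, by simp, ?_⟩
          unfold returned
          rw [if_pos ha, if_neg (hC.notMem_byz hz), List.mem_map]
          refine ⟨t', List.mem_filter.2 ⟨ht', ?_⟩, by rw [htl]; rfl⟩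
          rw [hs]
          simp [htl]
        · exact hrest
    · refine ⟨z, hz, t', ?_, hto', htd', ?_⟩
      · simp only [returnRound, if_neg (hC.notMem_byz hz), List.mem_append]
        refine Or.inl (List.mem_filter.2 ⟨ht', ?_⟩)
        rw [hs]
        simpa using hx
      · match htl : t'.trail with
        | [] =>
          rw [htl] at htr'
          exact htr'
        | x :: l =>
          rw [htl] at htr' hx
          obtain ⟨h₁, h₂, h₃, h₄, h₅⟩ := htr'
          refine ⟨h₁, h₂, h₃, ?_, h₅⟩
          -- The next step to undo was not made in round `half - k`, for otherwise its static core
          -- link would let the token move now. So its stamp is at most `half - (k + 1)` and the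
          -- invariant persists while the token waits.
          have hne : x.2 ≠ P.half - k := by
            rintro hxk
            exact hx ⟨x.1, (hS z hz x.1 h₁).2 h₂, by simp [← hxk]⟩
          omega

/-- The located token at the end of round `r`, in terms of the history of the walk stage. -/
theorem exists_located (hsupp : ∀ S u t, (rule S u t).support ⊆ (pick S u).support)
    (hC : StaticCore P C) {w : V × ℕ} (hw : w ∈ P.tokens C) {r k : ℕ} (hrk : r + k = P.half)
    {h : History V} (hh : h ∈ (execution P rule P.half).support)
    (hwalk : WalksIn C h w) (hq : QueueBounded C P.cap h) :
    ∃ c h', h.drop k = c :: h' ∧ c ∈ h ∧ Located P C w r ⟨c.outbox, c.ended⟩ := by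
  rw [← hrk] at hh
  have hd := drop_mem_support hh
  have hl := length_of_mem_support hd
  match hm : h.drop k with
  | [] => simp [hm] at hl
  | c :: h' =>
    have hsub : c :: h' ⊆ h := hm ▸ (List.drop_sublist k h).subset
    rw [hm] at hd
    exact ⟨c, h', rfl, hsub List.mem_cons_self, located_of_mem_support hsupp hC hw (by omega) hd
      (hwalk.mono hsub) (hq.mono hsub)⟩

/-- If the buffers are bounded, then a token that walks only in `C` ends in time. -/
theorem exists_ended (hsupp : ∀ S u t, (rule S u t).support ⊆ (pick S u).support)
    (hC : StaticCore P C) {w : V × ℕ} (hw : w ∈ P.tokens C) {k : ℕ}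
    (hrk : 2 * P.rwLength + k = P.half)
    {h : History V} (hh : h ∈ (execution P rule P.half).support)
    (hwalk : WalksIn C h w) (hq : QueueBounded C P.cap h) :
    ∃ c h', h.drop k = c :: h' ∧ c ∈ h ∧ ∃ u ∈ C, ∃ t ∈ c.ended u, t.origin = some w ∧
      t.counter = P.rwLength ∧ t.dest = some u ∧ TrailOK P C w.1 u P.half t.trail := by
  obtain ⟨c, h', hd, hc, hloc⟩ := exists_located hsupp hC hw hrk hh hwalk hq
  refine ⟨c, h', hd, hc, ?_⟩
  rcases hloc with ⟨u, hu, t, ht, h₁, h₂, h₃, h₄⟩ | ⟨u, _, v, _, _, t, _, _, hlt, _, hm⟩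
  · exact ⟨u, hu, t, ht, h₁, h₂, h₃, h₄.mono (by omega)⟩
  -- A waiting token would have `2 * rwLength ≤ 2 * counter + 1` with `counter < rwLength`.
  · omega

theorem walked_ended_back (hsupp : ∀ S u t, (rule S u t).support ⊆ (pick S u).support)
    (hC : StaticCore P C) {w : V × ℕ} (hw : w ∈ P.tokens C) {τ : ℕ} (hτ : P.rwLength = 2 * τ)
    (hhalf : 2 * P.rwLength ≤ P.half) {h : History V}
    (hh : h ∈ (execution P rule (2 * P.half)).support)
    (hwalk : WalksIn C h w) (hq : QueueBounded C P.cap (h.drop P.half)) :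
    WalkedBy h w P.rwLength τ ∧ ∃ u ∈ C, EndedBy h w (2 * P.rwLength) P.rwLength u ∧
      BackBy h w (2 * P.half) u := by
  have h2 : 2 * P.half = P.half + P.half := two_mul _
  have hd : h.drop P.half ∈ (execution P rule P.half).support :=
    drop_mem_support (by rwa [← h2])
  have hwalkd : WalksIn C (h.drop P.half) w := hwalk.mono (List.drop_sublist _ h).subset
  have hconf : ∀ r k, r + k = P.half → ∀ c h', (h.drop P.half).drop k = c :: h' →
      configAt h r = some c := by
    intro r k hrk c h' hc
    rw [configAt_eq_head_drop (r := r) (k := P.half + k) (by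
      rw [show r + (P.half + k) = 2 * P.half by omega]
      exact hh), ← List.drop_drop, hc]
    rfl
  constructor
  · obtain ⟨c, h', hc, _, hloc⟩ := exists_located hsupp hC hw
      (r := P.rwLength) (k := P.half - P.rwLength) (by omega) hd hwalkd hq
    refine ⟨c, hconf _ _ (by omega) c h' hc, ?_⟩
    rcases hloc with ⟨u, hu, t, ht, h₁, h₂, _⟩ | ⟨u, _, v, _, _, t, ht, h₁, _, _, hm⟩
    · exact ⟨t, ⟨u, Or.inl ht⟩, h₁, by omega⟩
    · exact ⟨t, ⟨u, Or.inr ⟨v, ht⟩⟩, h₁, by omega⟩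
  · obtain ⟨c, h', hc, hcm, u, hu, t, ht, h₁, h₂, h₃, h₄⟩ := exists_ended hsupp hC hw
      (k := P.half - 2 * P.rwLength) (by omega) hd hwalkd hq
    refine ⟨u, hu, ⟨c, hconf _ _ (by omega) c h' hc, t, ht, h₁, h₂⟩, ?_⟩
    match hm : h.drop P.half with
    | [] => simp [hm] at hcm
    | e :: h'' =>
      rw [hm] at hd hcm
      have hte := ended_subset_head hd hcm u ht
      obtain ⟨d, hdh, u', _, t', ht', h₁', h₂', h₃'⟩ := retraces hC le_rfl
        (by rwa [← h2]) (by rw [hm]; rfl) hu hte h₁ h₃ h₄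
      rw [Nat.sub_self] at h₃'
      -- All stamps are at least `1`, and after the whole way back at most `0`.
      have hnil : t'.trail = [] := by
        match htl : t'.trail with
        | [] => rfl
        | x :: l =>
          rw [htl] at h₃'
          have := h₃'.2.2
          omega
      rw [hnil] at h₃'
      have hsrc : u' = w.1 := h₃'
      refine ⟨d, ?_, t', hsrc ▸ ht', h₁', hnil, h₂'⟩
      rw [configAt_eq_head_drop (r := 2 * P.half) (k := 0) hh]
      exact hdh

end Track

/-! ## Additive functionals of the buffers -/

section Load

variable {V : Type} [Fintype V]

theorem sum_map_tokenList (f : V → List (Token V)) (μ : V × Token V → ℝ≥0∞) :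
    ((tokenList f).map μ).sum = ∑ v, ((f v).map fun t => μ (v, t)).sum := by
  rw [← Finset.sum_map_toList, tokenList, List.map_flatMap, List.flatMap, List.sum_flatten,
    List.map_map]
  simp [Function.comp_def]

theorem prod_map_tokenList (f : V → List (Token V)) (μ : V × Token V → ℝ≥0∞) :
    ((tokenList f).map μ).prod = ∏ v, ((f v).map fun t => μ (v, t)).prod := by
  rw [← Finset.prod_map_toList, tokenList, List.map_flatMap, List.flatMap, List.prod_flatten,
    List.map_map]
  simp [Function.comp_def]

/-- The sum of `α` over the waiting tokens (at their next node) and of `β` over the ended ones. -/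
def load (α β : V → Token V → ℝ≥0∞) (s : Buffers V) : ℝ≥0∞ :=
  ∑ u, ∑ v, ((s.outbox u v).map (α v)).sum + ∑ u, ((s.ended u).map (β u)).sum

variable {α β : V → Token V → ℝ≥0∞}

theorem load_push (s : Buffers V) (u v : V) (t : Token V) :
    load α β (s.push u v t) = load α β s + α v t := by
  have h : ∀ u' v', (((s.push u v t).outbox u' v').map (α v')).sum =
      ((s.outbox u' v').map (α v')).sum + if u' = u then (if v' = v then α v t else 0) else 0 := by
    intro u' v'
    rw [Buffers.push_outbox]
    split_ifs with h₁ h₂ h₃ h₄ h₅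
    · obtain ⟨rfl, rfl⟩ := h₁
      simp
    all_goals simp_all
  simp only [load, h, Buffers.push_ended, Finset.sum_add_distrib]
  simp only [Finset.sum_ite_irrel, Finset.sum_const_zero, Finset.sum_ite_eq', Finset.mem_univ,
    if_true]
  ring

theorem load_finish (s : Buffers V) (u : V) (t : Token V) :
    load α β (s.finish u t) = load α β s + β u { t with dest := some u } := by
  have h : ∀ u', (((s.finish u t).ended u').map (β u')).sum =
      ((s.ended u').map (β u')).sum + if u' = u then β u { t with dest := some u } else 0 := by
    intro u'
    rw [Buffers.finish_ended]
    split_ifs with h₁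
    · subst h₁
      simp
    · simp
  simp only [load, h, Buffers.finish_outbox, Finset.sum_add_distrib, Finset.sum_ite_eq',
    Finset.mem_univ, if_true]
  ring

variable {P : Phase V} {rule : Rule V} {S : Snapshot V}

/-- The functional is additive over tokens, so the cost of each handled token can be bounded by its
own `μ` and no independence is needed. -/
theorem expect_load_handleAll_le {μ : V × Token V → ℝ≥0∞} {l : List (V × Token V)}
    (hend : ∀ x ∈ l, P.rwLength ≤ x.2.counter → β x.1 { x.2 with dest := some x.1 } ≤ μ x)
    (hdraw : ∀ x ∈ l, x.2.counter < P.rwLength →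
      expect (rule S x.1 x.2) (fun v => α v x.2) ≤ μ x) (s : Buffers V) :
    expect (handleAll P rule S l s) (load α β) ≤ load α β s + (l.map μ).sum := by
  have key := expect_handleAll_le (P := P) (rule := rule) (S := S)
    (fun l s => load α β s + (l.map μ).sum) l (fun x hx xs s => ?_) s
  · simpa using key
  · rcases le_or_gt P.rwLength x.2.counter with h | h
    · rw [handle_of_le h, expect_pure, load_finish, List.map_cons, List.sum_cons, add_assoc]
      gcongr
      exact hend x hx h
    · rw [handle_of_lt h, expect_map]
      simp only [load_push, List.map_cons, List.sum_cons]
      rw [expect_add, expect_const, expect_add, expect_const, add_assoc]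
      gcongr
      exact hdraw x hx h

theorem load_handleAll_le {μ : V × Token V → ℝ≥0∞} {l : List (V × Token V)}
    (hend : ∀ x ∈ l, β x.1 { x.2 with dest := some x.1 } ≤ μ x)
    (hdraw : ∀ x ∈ l, ∀ v, α v x.2 ≤ μ x) {s s' : Buffers V}
    (hs : s' ∈ (handleAll P rule S l s).support) :
    load α β s' ≤ load α β s + (l.map μ).sum := by
  induction l generalizing s with
  | nil =>
    rw [handleAll, PMF.mem_support_pure_iff] at hs
    subst hs
    simp
  | cons x xs ih =>
    rw [handleAll, PMF.mem_support_bind_iff] at hs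
    obtain ⟨s₁, h₁, h₂⟩ := hs
    refine (ih (fun y hy => hend y (List.mem_cons_of_mem _ hy))
      (fun y hy => hdraw y (List.mem_cons_of_mem _ hy)) h₂).trans ?_
    rw [List.map_cons, List.sum_cons, ← add_assoc]
    gcongr
    rcases mem_support_handle h₁ with ⟨_, rfl⟩ | ⟨_, y, _, rfl⟩
    · rw [load_finish]
      gcongr
      exact hend x List.mem_cons_self
    · rw [load_push]
      gcongr
      exact hdraw x List.mem_cons_self y

/-- Sending does not increase a functional that a step preserves. -/
theorem load_kept_add_received_le {μ : V × Token V → ℝ≥0∞}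
    (hμ : ∀ v (t : Token V) tr, μ (v, { t with counter := t.counter + 1, trail := tr }) = α v t)
    (hα : ∀ v t, t.origin = none → α v t = 0) (h : History V) (c : Config V) (S : Snapshot V) :
    load α β ⟨kept P c S, c.ended⟩ + ((tokenList (received P h c S)).map μ).sum ≤
      load α β ⟨c.outbox, c.ended⟩ := by
  have hrec : ∀ v, ((received P h c S v).map fun t => μ (v, t)).sum ≤
      ∑ u, ((accepted P h c S u v).map (α v)).sum := by
    intro v
    by_cases hv : v ∈ P.byz
    · simp [received, hv]
    · rw [((perm_received h c S hv).map _).sum_eq, ← Finset.sum_map_toList, List.map_flatMap,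
        List.flatMap, List.sum_flatten, List.map_map]
      simp [Function.comp_def, hμ]
  -- Only an inequality: tokens disappear with vanished links, or at receivers that refuse them.
  -- Forged tokens have no origin and weigh nothing.
  have hone : ∀ u v, ((kept P c S u v).map (α v)).sum + ((accepted P h c S u v).map (α v)).sum ≤
      ((c.outbox u v).map (α v)).sum := by
    intro u v
    by_cases hg : S.graph.Adj u v ∧ u ∉ P.byz
    · have hk : kept P c S u v = (c.outbox u v).drop P.cap := if_pos hg
      have ha : ((accepted P h c S u v).map (α v)).sum ≤
          (((c.outbox u v).take P.cap).map (α v)).sum := by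
        unfold accepted sent
        rw [if_pos hg.1, if_neg hg.2]
        split_ifs
        · simp
        · rw [List.take_take, min_self]
      rw [hk]
      refine (add_le_add_right ha _).trans ?_
      rw [add_comm, ← List.sum_append, ← List.map_append, List.take_append_drop]
    · have hk : kept P c S u v = [] := if_neg hg
      have ha : ((accepted P h c S u v).map (α v)).sum = 0 := by
        refine List.sum_eq_zero fun x hx => ?_
        obtain ⟨t, ht, rfl⟩ := List.mem_map.1 hx
        rcases hto : t.origin with _ | w
        · exact hα v t hto
        · have := mem_accepted ht hto
          exact absurd ⟨this.1, this.2.1⟩ hg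
      rw [hk, ha]
      simp
  rw [sum_map_tokenList]
  refine (add_le_add_right (Finset.sum_le_sum fun v _ => hrec v) _).trans ?_
  rw [Finset.sum_comm (f := fun v u => ((accepted P h c S u v).map (α v)).sum)]
  unfold load
  rw [add_right_comm, ← Finset.sum_add_distrib]
  simp only [← Finset.sum_add_distrib]
  gcongr with u _ v _
  exact hone u v

/-- The labels `(v, i)` of created tokens are pairwise distinct, so at most one term is nonzero. -/
theorem sum_created_le {w : V × ℕ} {μ : V × Token V → ℝ≥0∞} {a : ℝ≥0∞}
    (hw : μ (w.1, ⟨some w, 0, [], none⟩) ≤ a)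
    (hμ : ∀ v (t : Token V), t.origin ≠ some w → μ (v, t) = 0) :
    ((tokenList (created P)).map μ).sum ≤ a := by
  rw [sum_map_tokenList, Finset.sum_eq_single w.1]
  · unfold created
    split_ifs with hv
    · rw [List.map_map]
      have hle : ∀ n, ((List.range n).map ((fun t => μ (w.1, t)) ∘
          fun i => (⟨some (w.1, i), 0, [], none⟩ : Token V))).sum ≤
          if w.2 < n then a else 0 := by
        intro n
        induction n with
        | zero => simp
        | succ n ih =>
          rw [List.range_succ, List.map_append, List.sum_append]
          simp only [List.map_cons, List.map_nil, List.sum_cons, List.sum_nil, add_zero,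
            Function.comp_apply]
          by_cases hn : w.2 = n
          · rw [if_neg (by omega)] at ih
            rw [if_pos (by omega), ← hn]
            calc _ ≤ 0 + a := add_le_add (hn ▸ ih) hw
              _ = a := zero_add a
          · rw [hμ _ _ fun h => hn (by rw [← Option.some.inj h]), add_zero]
            refine ih.trans ?_
            split_ifs <;> first | omega | simp
      refine (hle _).trans ?_
      split_ifs <;> simp
    · simp
  · intro v _ hv
    refine List.sum_eq_zero fun x hx => ?_
    obtain ⟨t, ht, rfl⟩ := List.mem_map.1 hx
    obtain ⟨_, i, _, rfl⟩ := mem_created ht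
    refine hμ _ _ fun h => hv ?_
    rw [← Option.some.inj h]
  · simp

/-- The number of copies of the token `w`. -/
def copies (w : V × ℕ) : Buffers V → ℝ≥0∞ :=
  load (fun _ t => if t.origin = some w then 1 else 0) fun _ t => if t.origin = some w then 1 else 0

theorem load_empty : load α β ⟨fun _ _ => [], fun _ => []⟩ = 0 := by
  simp [load]

/-- Tokens are never duplicated. -/
theorem copies_le_one (w : V × ℕ) {r : ℕ} {c : Config V} {h : History V}
    (hh : (c :: h) ∈ (execution P rule r).support) : copies w ⟨c.outbox, c.ended⟩ ≤ 1 := by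
  induction r generalizing c h with
  | zero =>
    obtain ⟨s, hs, he⟩ := mem_support_startLaw hh
    obtain ⟨rfl, rfl⟩ := List.cons.inj he
    refine (load_handleAll_le (μ := fun x => if x.2.origin = some w then 1 else 0)
      (fun _ _ => le_rfl) (fun _ _ _ => le_rfl) hs).trans ?_
    rw [load_empty, zero_add]
    exact sum_created_le (by simp) fun v t ht => if_neg ht
  | succ r ih =>
    obtain ⟨c₀, h₀, h₁, ⟨_, c', hc', he⟩ | ⟨_, he⟩⟩ := mem_support_execution_succ hh
    · obtain ⟨rfl, rfl⟩ := List.cons.inj he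
      obtain ⟨s, hs, rfl⟩ := mem_support_walkRound hc'
      refine (load_handleAll_le (μ := fun x => if x.2.origin = some w then 1 else 0)
        (fun _ _ => le_rfl) (fun _ _ _ => le_rfl) hs).trans
        ((load_kept_add_received_le (fun _ _ _ => rfl) (fun _ t ht => ?_) _ _ _).trans (ih h₁))
      simp [ht]
    · obtain ⟨rfl, rfl⟩ := List.cons.inj he
      have ih := ih h₁
      exact ih

/-- The token with the modified rule is not drawn uniformly; since it occurs at most once per round,
it spoils the buffer estimate by a single factor `1 + D` per round. -/
theorem countP_received_le_one (w : V × ℕ) {r : ℕ} {c : Config V} {h : History V}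
    (hh : (c :: h) ∈ (execution P rule r).support) (S : Snapshot V) (u : V) :
    (received P (c :: h) c S u).countP (fun t => t.origin = some w) ≤ 1 := by
  have hsum := (load_kept_add_received_le (P := P)
    (α := fun _ t => if t.origin = some w then 1 else 0)
    (β := fun _ t => if t.origin = some w then 1 else 0)
    (μ := fun x => if x.2.origin = some w then 1 else 0)
    (fun _ _ _ => rfl) (fun _ t ht => by simp [ht]) (c :: h) c S).trans (copies_le_one w hh)
  have h₂ := (le_add_self).trans hsum
  rw [sum_map_tokenList] at h₂
  have h₃ := (Finset.single_le_sum (f := fun v => ((received P (c :: h) c S v).map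
    fun t => if t.origin = some w then (1 : ℝ≥0∞) else 0).sum) (fun _ _ => zero_le)
    (Finset.mem_univ u)).trans h₂
  have h₄ : ∀ l : List (Token V), (l.map fun t => if t.origin = some w then (1 : ℝ≥0∞) else 0).sum =
      (l.countP fun t => t.origin = some w : ℕ) := by
    intro l
    induction l with
    | nil => simp
    | cons t l ih =>
      rw [List.map_cons, List.sum_cons, ih, List.countP_cons]
      by_cases ht : t.origin = some w <;> simp [ht, add_comm]
  rw [h₄] at h₃
  exact_mod_cast h₃

end Load

/-! ## Buffer lengths -/

section Queue

variable {V : Type} [Fintype V] {P : Phase V} {rule : Rule V} {C : Finset V}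

theorem pick_apply_le {S : Snapshot V} {u : V} (hu : (nbrs S u).Nonempty) (v : V) :
    pick S u v ≤ ((nbrs S u).card : ℝ≥0∞)⁻¹ := by
  unfold pick
  rw [dif_pos hu, PMF.uniformOfFinset_apply]
  split_ifs <;> simp

/-- The factor by which handling a token can increase the expected value of
`(1 + D) ^ (length of the buffer from u)`. -/
def growth (w : V × ℕ) (S : Snapshot V) (u : V) (D : ℝ≥0∞) (x : V × Token V) : ℝ≥0∞ :=
  if x.1 = u then (if x.2.origin = some w then 1 + D else 1 + D * ((nbrs S u).card : ℝ≥0∞)⁻¹) else 1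

theorem one_le_growth (w : V × ℕ) (S : Snapshot V) (u : V) (D : ℝ≥0∞) (x : V × Token V) :
    1 ≤ growth w S u D x := by
  unfold growth
  split_ifs <;> simp

/-- A uniform draw at `u` lengthens the given buffer with probability at most one over the degree,
which multiplies the conditional expectation by at most `1 + D / degree`. For the exceptional token
the worst case `1 + D` is taken. -/
theorem expect_pow_handleAll_le {w : V × ℕ}
    (hrule : ∀ S u t, t.origin ≠ some w → rule S u t = pick S u) {S : Snapshot V} {u v : V}
    (hu : (nbrs S u).Nonempty) (D : ℝ≥0∞) (l : List (V × Token V)) (s : Buffers V) :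
    expect (handleAll P rule S l s) (fun s' => (1 + D) ^ (s'.outbox u v).length) ≤
      (1 + D) ^ (s.outbox u v).length * (l.map (growth w S u D)).prod := by
  have key := expect_handleAll_le (P := P) (rule := rule) (S := S)
    (fun l s => (1 + D) ^ (s.outbox u v).length * (l.map (growth w S u D)).prod) l
    (fun x hx xs s => ?_) s
  · simpa using key
  · rw [List.map_cons, List.prod_cons, ← mul_assoc, expect_mul_right]
    gcongr
    rcases le_or_gt P.rwLength x.2.counter with h | h
    · rw [handle_of_le h, expect_pure, Buffers.finish_outbox]
      exact le_mul_of_one_le_right' (one_le_growth w S u D x)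
    · rw [handle_of_lt h, expect_map]
      simp only [Buffers.push_outbox]
      unfold growth
      split_ifs with hx₁ hx₂
      · refine expect_le_const fun y _ => ?_
        split_ifs with hy
        · rw [← hy.1, ← hy.2, List.length_append, pow_add]
          simp
        · exact le_mul_of_one_le_right' (by simp)
      · have hy : ∀ y, (1 + D) ^ (if u = x.1 ∧ v = y then s.outbox x.1 y ++ [x.2]
            else s.outbox u v).length =
            (1 + D) ^ (s.outbox u v).length * (1 + D * if v = y then 1 else 0) := by
          intro y
          by_cases hy : v = y
          · subst hy
            simp [hx₁, pow_add]
          · simp [hy]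
        simp only [hy]
        rw [expect_mul_left, expect_add, expect_const, expect_mul_left, hrule _ _ _ hx₂, hx₁]
        gcongr
        unfold expect
        rw [tsum_eq_single v fun y hy => by simp [hy.symm]]
        simpa using pick_apply_le hu v
      · have hy : ∀ y, (if u = x.1 ∧ v = y then s.outbox x.1 y ++ [x.2]
            else s.outbox u v) = s.outbox u v := fun y => if_neg fun h => hx₁ h.1.symm
        simp only [hy, expect_const, mul_one, le_refl]

theorem prod_growth_tokenList (w : V × ℕ) (S : Snapshot V) (u : V) (D : ℝ≥0∞)
    (f : V → List (Token V)) :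
    ((tokenList f).map (growth w S u D)).prod =
      ((f u).map fun t => growth w S u D (u, t)).prod := by
  rw [prod_map_tokenList, Finset.prod_eq_single u]
  · intro v _ hv
    refine List.prod_eq_one fun x hx => ?_
    obtain ⟨t, _, rfl⟩ := List.mem_map.1 hx
    exact if_neg hv
  · simp

theorem prod_growth_le (w : V × ℕ) (S : Snapshot V) (u : V) (D : ℝ≥0∞) (l : List (Token V)) :
    (l.map fun t => growth w S u D (u, t)).prod ≤
      (1 + D) ^ l.countP (fun t => t.origin = some w) *
        (1 + D * ((nbrs S u).card : ℝ≥0∞)⁻¹) ^ l.length := by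
  induction l with
  | nil => simp
  | cons t l ih =>
    rw [List.map_cons, List.prod_cons, List.countP_cons, List.length_cons, pow_succ]
    by_cases ht : t.origin = some w
    · have hg : growth w S u D (u, t) = 1 + D := by simp [growth, ht]
      rw [hg]
      simp only [ht, decide_true, if_true, pow_succ]
      calc _ ≤ (1 + D) * ((1 + D) ^ l.countP (fun t => t.origin = some w) *
            (1 + D * ((nbrs S u).card : ℝ≥0∞)⁻¹) ^ l.length) := by gcongr
        _ = (1 + D) ^ l.countP (fun t => t.origin = some w) * (1 + D) *
            ((1 + D * ((nbrs S u).card : ℝ≥0∞)⁻¹) ^ l.length * 1) := by ring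
        _ ≤ _ := by
            gcongr
            simp
    · have hg : growth w S u D (u, t) = 1 + D * ((nbrs S u).card : ℝ≥0∞)⁻¹ := by
        simp [growth, ht]
      rw [hg]
      simp only [ht, decide_false]
      calc _ ≤ (1 + D * ((nbrs S u).card : ℝ≥0∞)⁻¹) *
            ((1 + D) ^ l.countP (fun t => t.origin = some w) *
            (1 + D * ((nbrs S u).card : ℝ≥0∞)⁻¹) ^ l.length) := by gcongr
        _ = _ := by simp; ring

/-- The length of the buffer of `u` towards `v` at the end of the history. -/
def queueLength (u v : V) : History V → ℕ
  | [] => 0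
  | c :: _ => (c.outbox u v).length

theorem nbrs_nonempty (hC : StaticCore P C) {S : Snapshot V}
    (hS : ∀ u ∈ C, ∀ v ∈ C, S.graph.Adj u v ↔ P.start.graph.Adj u v) {u : V} (hu : u ∈ C) :
    (nbrs S u).Nonempty := by
  obtain ⟨x, hx, ha⟩ := hC.exists_adj u hu
  exact ⟨x, adj_iff_mem_nbrs.2 ((hS u hu x hx).2 ha)⟩

/-- A buffer shorter than `cap` is emptied rather than shortened by `cap`; the summand `1` pays for
this truncation. -/
theorem pow_tsub_le {D : ℝ≥0∞} (hD : D ≠ ∞) (n k : ℕ) :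
    (1 + D) ^ (n - k) ≤ (1 + D) ^ n * ((1 + D) ^ k)⁻¹ + 1 := by
  have h0 : (1 + D) ^ k ≠ 0 := pow_ne_zero _ (by simp)
  have ht : (1 + D) ^ k ≠ ∞ := ENNReal.pow_ne_top (by simp [hD])
  rcases le_total k n with h | h
  · obtain ⟨m, rfl⟩ := Nat.exists_eq_add_of_le h
    rw [Nat.add_sub_cancel_left, pow_add, mul_comm ((1 + D) ^ k), mul_assoc,
      ENNReal.mul_inv_cancel h0 ht, mul_one]
    exact le_self_add
  · rw [Nat.sub_eq_zero_of_le h, pow_zero]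
    exact le_add_self

/-- Here `G` bounds the effect of the uniform arrivals of a round, `1 + D` that of the exceptional
token, and sending divides by `(1 + D)^cap`. The net growth per round is `g`, close to `1` for small
`D`. Each truncation restarts the growth from `1`, which produces the linear factor `r + 1`. -/
theorem expect_pow_queueLength_le {w : V × ℕ}
    (hrule : ∀ S u t, t.origin ≠ some w → rule S u t = pick S u) (hC : StaticCore P C)
    (hinit : ∀ u ∈ C, P.init u ≤ P.cap) {D G g : ℝ≥0∞} (hD : D ≠ ∞)
    (hG : ∀ d : ℕ, 0 < d → (1 + D * (d : ℝ≥0∞)⁻¹) ^ (d * P.cap) ≤ G)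
    (hg : (1 + D) * G ≤ g * (1 + D) ^ P.cap) (hg1 : 1 ≤ g) {u : V} (hu : u ∈ C) (v : V)
    {r : ℕ} (hr : r ≤ P.half) :
    expect (execution P rule r) (fun h => (1 + D) ^ queueLength u v h) ≤
      (r + 1) * g ^ (r + 1) * (1 + D) ^ P.cap := by
  induction r with
  | zero =>
    have hne := nbrs_nonempty hC (S := P.start) (fun _ _ _ _ => Iff.rfl) hu
    rw [execution, startLaw_eq, expect_map]
    refine (expect_pow_handleAll_le hrule hne D _ _).trans ?_
    rw [prod_growth_tokenList]
    have hlen : (created P u).length ≤ P.cap := by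
      unfold created
      split_ifs
      · simpa using hinit u hu
      · simp
    have hgr : ∀ t : Token V, growth w P.start u D (u, t) ≤ 1 + D := by
      intro t
      unfold growth
      rw [if_pos rfl]
      split_ifs
      · exact le_rfl
      · gcongr
        refine mul_le_of_le_one_right' (ENNReal.inv_le_one.2 ?_)
        exact_mod_cast hne.card_pos
    have hprod : ((created P u).map fun t => growth w P.start u D (u, t)).prod ≤
        (1 + D) ^ (created P u).length := by
      refine (List.prod_le_pow_card _ (1 + D) fun x hx => ?_).trans (by simp)
      obtain ⟨t, _, rfl⟩ := List.mem_map.1 hx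
      exact hgr t
    simp only [List.length_nil, pow_zero, one_mul, Nat.cast_zero, zero_add, pow_one]
    calc _ ≤ (1 + D) ^ (created P u).length := hprod
      _ ≤ (1 + D) ^ P.cap := pow_le_pow_right₀ (by simp) hlen
      _ ≤ _ := le_mul_of_one_le_left' hg1
  | succ r ih =>
    have ih := ih (by omega)
    set Y := (1 + D) ^ P.cap with hY
    have h0 : Y ≠ 0 := pow_ne_zero _ (by simp)
    have ht : Y ≠ ∞ := ENNReal.pow_ne_top (by simp [hD])
    have hstep : ∀ h ∈ (execution P rule r).support,
        expect (nextRound P rule h) (fun h => (1 + D) ^ queueLength u v h) ≤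
          ((1 + D) ^ queueLength u v h * Y⁻¹ + 1) * ((1 + D) * G) := by
      intro h hh
      have hlen := length_of_mem_support hh
      match h, hlen with
      | c :: h, hlen =>
        simp only [nextRound]
        rw [if_pos (by omega), expect_map, walkRound_eq, expect_map]
        set S := P.adv.net (c :: h) with hS
        have hne := nbrs_nonempty hC (hC.static (c :: h)) hu
        refine (expect_pow_handleAll_le hrule hne D _ _).trans (mul_le_mul' ?_ ?_)
        · exact (pow_le_pow_right₀ (by simp) (kept_length_le c S u v)).trans (pow_tsub_le hD _ _)
        · rw [prod_growth_tokenList]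
          refine (prod_growth_le w S u D _).trans (mul_le_mul' ?_ ?_)
          · calc _ ≤ (1 + D) ^ 1 := pow_le_pow_right₀ (by simp) (countP_received_le_one w hh S u)
              _ = 1 + D := pow_one _
          · exact (pow_le_pow_right₀ (by simp) (received_length_le _ _ _ _)).trans
              (hG _ hne.card_pos)
    rw [execution, expect_bind]
    refine (expect_mono hstep).trans ?_
    rw [expect_mul_right, expect_add, expect_const, expect_mul_right]
    -- The divisor `Y` gained by sending cancels the `Y` of the induction hypothesis, and `hg` turns
    -- `(1 + D) * G` into `g * Y`.
    calc _ ≤ ((r + 1) * g ^ (r + 1) * Y * Y⁻¹ + 1) * (g * Y) := by gcongr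
      _ = ((r + 1) * g ^ (r + 1) + 1) * (g * Y) := by
          rw [mul_assoc _ Y, ENNReal.mul_inv_cancel h0 ht, mul_one]
      _ ≤ ((r + 1) * g ^ (r + 1) + g ^ (r + 1)) * (g * Y) := by
          gcongr
          exact one_le_pow₀ hg1
      _ = _ := by
          push_cast
          ring

/-- Rounds only prepend configurations, so the law of an earlier stage is a marginal of the later
one. This transfers walk-stage bounds to the whole phase. -/
theorem expect_execution_drop (r k : ℕ) (f : History V → ℝ≥0∞) :
    expect (execution P rule (r + k)) (fun h => f (h.drop k)) = expect (execution P rule r) f := by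
  induction k with
  | zero => rfl
  | succ k ih =>
    rw [← ih, ← add_assoc, execution, expect_bind]
    refine expect_congr fun h hh => ?_
    have hlen := length_of_mem_support hh
    rw [← expect_const (nextRound P rule h) (f (h.drop k))]
    refine expect_congr fun h' hh' => ?_
    match h, hlen with
    | c :: h, hlen =>
      rcases mem_support_nextRound hh' with ⟨_, c', _, rfl⟩ | ⟨_, rfl⟩ <;> rfl

theorem expect_sum {α ι : Type} (p : PMF α) (s : Finset ι) (f : ι → α → ℝ≥0∞) :
    expect p (fun x => ∑ i ∈ s, f i x) = ∑ i ∈ s, expect p (f i) := by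
  induction s using Finset.induction_on with
  | empty => simp [expect_const]
  | insert i s hi ih => simp only [Finset.sum_insert hi, expect_add, ih]

/-- Union bound over the configurations and pairs of core nodes, with Markov's inequality for
`X^length` at the threshold `X^(2 * cap)`. -/
theorem toOuterMeasure_not_queueBounded_le {X B : ℝ≥0∞} (hX : 1 ≤ X) (hX' : X ≠ ∞)
    (hB : ∀ r ≤ P.half, ∀ u ∈ C, ∀ v ∈ C,
      expect (execution P rule r) (fun h => X ^ queueLength u v h) ≤ B) {r : ℕ}
    (hr : r ≤ P.half) :
    (execution P rule r).toOuterMeasure {h | ¬ QueueBounded C P.cap h} ≤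
      (r + 1) * (C.card * (C.card * (B * (X ^ (2 * P.cap))⁻¹))) := by
  set Z := X ^ (2 * P.cap) with hZ
  have h0 : Z ≠ 0 := pow_ne_zero _ (zero_lt_one.trans_le hX).ne'
  have ht : Z ≠ ∞ := ENNReal.pow_ne_top hX'
  have hsum : ∀ r ≤ P.half, expect (execution P rule r)
      (fun h => ∑ u ∈ C, ∑ v ∈ C, X ^ queueLength u v h * Z⁻¹) ≤
        C.card * (C.card * (B * Z⁻¹)) := by
    intro r hr
    simp only [expect_sum, expect_mul_right]
    calc _ ≤ ∑ u ∈ C, ∑ v ∈ C, B * Z⁻¹ := by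
          gcongr with u hu v hv
          exact hB r hr u hu v hv
      _ = _ := by simp
  have hhead : ∀ c : Config V, ∀ h : History V, ¬ QueueBounded C P.cap (c :: h) →
      QueueBounded C P.cap h →
      1 ≤ ∑ u ∈ C, ∑ v ∈ C, X ^ queueLength u v (c :: h) * Z⁻¹ := by
    intro c h hc hh
    have : ¬ ∀ u ∈ C, ∀ v ∈ C, (c.outbox u v).length ≤ 2 * P.cap := fun hall => hc fun c' hc' => by
      rcases List.mem_cons.1 hc' with rfl | hc'
      · exact hall
      · exact hh c' hc'
    push Not at this
    obtain ⟨u, hu, v, hv, hlt⟩ := this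
    calc (1 : ℝ≥0∞) = Z * Z⁻¹ := (ENNReal.mul_inv_cancel h0 ht).symm
      _ ≤ X ^ queueLength u v (c :: h) * Z⁻¹ := by
          gcongr
          exact pow_le_pow_right₀ hX hlt.le
      _ ≤ ∑ v ∈ C, X ^ queueLength u v (c :: h) * Z⁻¹ :=
          Finset.single_le_sum (f := fun v => X ^ queueLength u v (c :: h) * Z⁻¹)
            (fun _ _ => zero_le) hv
      _ ≤ _ := Finset.single_le_sum (f := fun u => ∑ v ∈ C, X ^ queueLength u v (c :: h) * Z⁻¹)
            (fun _ _ => zero_le) hu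
  induction r with
  | zero =>
    refine (toOuterMeasure_le_expect (f := fun h => ∑ u ∈ C, ∑ v ∈ C,
      X ^ queueLength u v h * Z⁻¹) fun h hh hb => ?_).trans ((hsum 0 hr).trans (by simp))
    obtain ⟨s, _, rfl⟩ := mem_support_startLaw hh
    exact hhead _ _ hb fun c hc => by simp at hc
  | succ r ih =>
    have ih := ih (by omega)
    refine (toOuterMeasure_le_expect (f := fun h =>
      ({h | ¬ QueueBounded C P.cap h} : Set (History V)).indicator 1 (h.drop 1) +
        ∑ u ∈ C, ∑ v ∈ C, X ^ queueLength u v h * Z⁻¹) fun h hh hb => ?_).trans ?_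
    · obtain ⟨c, h₀, h₁, ⟨_, c', _, rfl⟩ | ⟨_, rfl⟩⟩ := mem_support_execution_succ hh <;>
      · by_cases hq : QueueBounded C P.cap (c :: h₀)
        · exact (hhead _ _ hb hq).trans le_add_self
        · refine le_trans ?_ le_self_add
          simp [hq]
    · rw [expect_add, expect_execution_drop (r := r) (k := 1), ← toOuterMeasure_eq_expect]
      refine (add_le_add ih (hsum (r + 1) hr)).trans (le_of_eq ?_)
      push_cast
      ring

end Queue

/-! ## The simple random walk on a finite graph -/

section Graph

variable {W : Type} [Fintype W] {H : SimpleGraph W}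

/-- The `k`-step transition probabilities. -/
def stepProb (H : SimpleGraph W) (k : ℕ) : Matrix W W ℝ := walkMatrix H ^ k

/-- A singleton at an isolated node has volume `0`, and division by zero makes its ratio `0 < φ`.
Two nodes are needed for a singleton to be an admissible set. -/
theorem degree_pos_of_conductance {φ : ℝ} (hφ : 0 < φ) (h : ConductanceAtLeast H φ)
    (hW : 2 ≤ Fintype.card W) (u : W) : 0 < H.degree u := by
  by_contra h0
  have h0 : H.degree u = 0 := by omega
  have := h {u} (Finset.singleton_nonempty u) (by simpa using hW)
  have hv : vol H {u} = 0 := by simp [vol, h0]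
  rw [hv, Nat.zero_min, Nat.cast_zero, div_zero] at this
  exact absurd this (not_le.2 hφ)

theorem walkMatrix_mem_rowStochastic (hd : ∀ u, 0 < H.degree u) :
    walkMatrix H ∈ Matrix.rowStochastic ℝ W := by
  rw [Matrix.mem_rowStochastic_iff_sum]
  refine ⟨fun u v => ?_, fun u => ?_⟩
  · unfold walkMatrix
    split_ifs <;> positivity
  · unfold walkMatrix
    rw [← Finset.sum_filter, Finset.sum_const, nsmul_eq_mul]
    have : (univ.filter fun v => H.Adj u v).card = H.degree u := by
      rw [← SimpleGraph.card_neighborFinset_eq_degree]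
      congr 1
      ext v
      simp
    rw [this]
    have := hd u
    field_simp

theorem stepProb_mem_rowStochastic (hd : ∀ u, 0 < H.degree u) (k : ℕ) :
    stepProb H k ∈ Matrix.rowStochastic ℝ W :=
  pow_mem (walkMatrix_mem_rowStochastic hd) k

theorem stepProb_nonneg (hd : ∀ u, 0 < H.degree u) (k : ℕ) (u v : W) : 0 ≤ stepProb H k u v :=
  Matrix.nonneg_of_mem_rowStochastic (stepProb_mem_rowStochastic hd k)

theorem sum_stepProb (hd : ∀ u, 0 < H.degree u) (k : ℕ) (u : W) : ∑ v, stepProb H k u v = 1 :=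
  Matrix.sum_row_of_mem_rowStochastic (stepProb_mem_rowStochastic hd k) u

theorem stepProb_zero (u v : W) : stepProb H 0 u v = if u = v then 1 else 0 := by
  rw [stepProb, pow_zero, Matrix.one_apply]

theorem stepProb_succ (k : ℕ) (u v : W) :
    stepProb H (k + 1) u v = ∑ x, walkMatrix H u x * stepProb H k x v := by
  rw [stepProb, pow_succ', Matrix.mul_apply]
  rfl

theorem stepProb_add (j k : ℕ) (u v : W) :
    stepProb H (j + k) u v = ∑ x, stepProb H j u x * stepProb H k x v := by
  rw [stepProb, pow_add, Matrix.mul_apply]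
  rfl

theorem card_le_sum_degree (hd : ∀ u, 0 < H.degree u) :
    Fintype.card W ≤ 2 * H.edgeFinset.card := by
  rw [← H.sum_degrees_eq_twice_card_edges, ← Finset.card_univ, Finset.card_eq_sum_ones]
  exact Finset.sum_le_sum fun u _ => hd u

/-- By reversibility the stationary flow over every directed edge is `1 / (2|E|)`. -/
theorem stationary_vecMul (hd : ∀ u, 0 < H.degree u) (k : ℕ) (v : W) :
    ∑ u, stationary H u * stepProb H k u v = stationary H v := by
  induction k generalizing v with
  | zero => simp [stepProb_zero]
  | succ k ih =>
    have hone : ∀ x, ∑ u, stationary H u * walkMatrix H u x = stationary H x := by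
      intro x
      have : ∀ u, stationary H u * walkMatrix H u x =
          if H.Adj x u then 1 / (2 * (H.edgeFinset.card : ℝ)) else 0 := by
        intro u
        have hu : (H.degree u : ℝ) ≠ 0 := by exact_mod_cast (hd u).ne'
        by_cases ha : H.Adj u x
        · rw [if_pos ha.symm, walkMatrix, if_pos ha, stationary]
          field_simp
        · rw [if_neg fun h => ha h.symm, walkMatrix, if_neg ha, mul_zero]
      simp only [this]
      rw [← Finset.sum_filter, Finset.sum_const, nsmul_eq_mul, stationary,
        ← SimpleGraph.card_neighborFinset_eq_degree, SimpleGraph.neighborFinset_eq_filter]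
      ring
    simp only [stepProb_succ, Finset.mul_sum]
    rw [Finset.sum_comm]
    simp only [← mul_assoc, ← Finset.sum_mul, hone]
    exact ih v

theorem sum_stationary [Nonempty W] (hd : ∀ u, 0 < H.degree u) : ∑ u, stationary H u = 1 := by
  have h : (0 : ℝ) < 2 * H.edgeFinset.card := by
    exact_mod_cast Fintype.card_pos.trans_le (card_le_sum_degree hd)
  unfold stationary
  rw [← Finset.sum_div, ← Nat.cast_sum, H.sum_degrees_eq_twice_card_edges]
  push_cast
  exact div_self h.ne'

theorem stepProb_sub_stationary_le {ε : ℝ} {t : ℕ} (h : MixedBy H ε t) (u v : W) :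
    |stepProb H t u v - stationary H v| ≤ ε := by
  have := h (Pi.single u 1) (single_mem_stdSimplex ℝ u) v
  rw [Matrix.single_one_vecMul] at this
  exact this

/-- Twice the mixing time squares the accuracy, up to the number of nodes. -/
theorem stepProb_two_mul_sub_stationary_le (hd : ∀ u, 0 < H.degree u) {ε : ℝ} {t : ℕ}
    (h : MixedBy H ε t) (u v : W) :
    |stepProb H (2 * t) u v - stationary H v| ≤ Fintype.card W * (ε * ε) := by
  have : Nonempty W := ⟨u⟩
  -- With `Π` the matrix all of whose rows are stationary and `M` the `t`-step matrix, `M * M - Π =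
  -- (M - Π) * (M - Π)`, because `M * Π = Π * M = Π * Π = Π`.
  have key : stepProb H (2 * t) u v - stationary H v =
      ∑ x, (stepProb H t u x - stationary H x) * (stepProb H t x v - stationary H v) := by
    simp only [sub_mul, mul_sub, Finset.sum_sub_distrib, ← Finset.sum_mul, sum_stepProb hd,
      sum_stationary hd, stationary_vecMul hd]
    rw [two_mul, stepProb_add]
    ring
  rw [key]
  refine (Finset.abs_sum_le_sum_abs _ _).trans ?_
  calc _ ≤ ∑ _x : W, ε * ε := by
        refine Finset.sum_le_sum fun x _ => ?_
        rw [abs_mul]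
        have h₁ := stepProb_sub_stationary_le h u x
        exact mul_le_mul h₁ (stepProb_sub_stationary_le h x v) (abs_nonneg _)
          ((abs_nonneg _).trans h₁)
    _ = _ := by simp

/-- Degrees between `1` and `Δ` give `|W| ≤ 2|E| ≤ Δ|W|`. -/
theorem stationary_bounds (hd : ∀ u, 0 < H.degree u) {Δ : ℕ} (hΔ : ∀ u, H.degree u ≤ Δ) (u : W) :
    1 / (Δ * (Fintype.card W : ℝ)) ≤ stationary H u ∧
      stationary H u ≤ Δ / (Fintype.card W : ℝ) := by
  have : Nonempty W := ⟨u⟩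
  have h₁ : (Fintype.card W : ℝ) ≤ 2 * H.edgeFinset.card := by
    exact_mod_cast card_le_sum_degree hd
  have h₂ : 2 * (H.edgeFinset.card : ℝ) ≤ Δ * Fintype.card W := by
    have : 2 * H.edgeFinset.card ≤ Fintype.card W * Δ := by
      rw [← H.sum_degrees_eq_twice_card_edges, ← Finset.card_univ, ← smul_eq_mul]
      exact Finset.sum_le_card_nsmul _ _ _ fun u _ => hΔ u
    rw [mul_comm (Δ : ℝ)]
    exact_mod_cast this
  have h₃ : (0 : ℝ) < Fintype.card W := by exact_mod_cast Fintype.card_pos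
  have h₄ : (1 : ℝ) ≤ H.degree u := by exact_mod_cast hd u
  have h₅ : (H.degree u : ℝ) ≤ Δ := by exact_mod_cast hΔ u
  unfold stationary
  constructor
  · gcongr
    linarith
  · gcongr

end Graph

/-! ## The core-conditioned execution -/

section Conditioned

variable {V : Type} {P : Phase V} {C : Finset V}

theorem degree_coreGraph (u : C) :
    (P.coreGraph C).degree u = (C.filter fun v => P.start.graph.Adj u v).card := by
  rw [← SimpleGraph.card_neighborFinset_eq_degree, SimpleGraph.neighborFinset_eq_filter]
  refine Finset.card_bij (fun v _ => (v : V)) ?_ ?_ ?_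
  · intro v hv
    have ha := (Finset.mem_filter.1 hv).2
    exact Finset.mem_filter.2 ⟨v.2, ha⟩
  · intro v _ v' _ h
    exact Subtype.ext h
  · intro v hv
    obtain ⟨hvC, ha⟩ := Finset.mem_filter.1 hv
    exact ⟨⟨v, hvC⟩, Finset.mem_filter.2 ⟨Finset.mem_univ _, ha⟩, rfl⟩

/-- The probability that the simple random walk on the core is at `u` after `k` steps from `x`. -/
def hitProb (P : Phase V) (C : Finset V) (u : C) (k : ℕ) (x : V) : ℝ≥0∞ :=
  if hx : x ∈ C then ENNReal.ofReal (stepProb (P.coreGraph C) k ⟨x, hx⟩ u) else 0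

theorem hitProb_zero (u : C) {x : V} (hx : x ∈ C) :
    hitProb P C u 0 x = if x = u then 1 else 0 := by
  unfold hitProb
  rw [dif_pos hx, stepProb_zero]
  by_cases h : x = u
  · subst h
    simp
  · rw [if_neg fun h' => h (congrArg Subtype.val h'), if_neg h, ENNReal.ofReal_zero]

variable [Fintype V]

theorem toOuterMeasure_execution_drop {rule : Rule V} (r k : ℕ) (s : Set (History V)) :
    (execution P rule (r + k)).toOuterMeasure {h | h.drop k ∈ s} =
      (execution P rule r).toOuterMeasure s := by
  rw [toOuterMeasure_eq_expect, toOuterMeasure_eq_expect, ← expect_execution_drop r k]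
  rfl

theorem protocolRule_support (S : Snapshot V) (u : V) (t : Token V) :
    (protocolRule S u t).support ⊆ (pick S u).support := subset_rfl

theorem condPick_support (S : Snapshot V) (u : V) :
    (condPick C S u).support ⊆ (pick S u).support := by
  unfold condPick
  split_ifs with h
  · exact fun v hv => ((PMF.mem_support_filter_iff h).1 hv).2
  · exact subset_rfl

theorem conditionedRule_support (w : V × ℕ) (S : Snapshot V) (u : V) (t : Token V) :
    (conditionedRule C w S u t).support ⊆ (pick S u).support := by
  unfold conditionedRule
  split_ifs
  · exact condPick_support S u
  · exact subset_rfl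

theorem conditionedRule_of_ne {w : V × ℕ} (S : Snapshot V) (u : V) (t : Token V)
    (ht : t.origin ≠ some w) : conditionedRule C w S u t = pick S u := if_neg ht

theorem pick_apply_of_nonempty {S : Snapshot V} {u : V} (hu : (nbrs S u).Nonempty) (v : V) :
    pick S u v = if S.graph.Adj u v then ((nbrs S u).card : ℝ≥0∞)⁻¹ else 0 := by
  unfold pick
  rw [dif_pos hu, PMF.uniformOfFinset_apply]
  simp only [adj_iff_mem_nbrs]

theorem exists_mem_support_pick (hC : StaticCore P C) {S : Snapshot V}
    (hS : ∀ u ∈ C, ∀ v ∈ C, S.graph.Adj u v ↔ P.start.graph.Adj u v) {u : V} (hu : u ∈ C) :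
    ∃ a ∈ (C : Set V), a ∈ (pick S u).support := by
  obtain ⟨x, hx, ha⟩ := hC.exists_adj u hu
  have hxS := (hS u hu x hx).2 ha
  refine ⟨x, hx, ?_⟩
  rw [PMF.mem_support_iff, pick_apply_of_nonempty (nbrs_nonempty hC hS hu), if_pos hxS]
  simp

theorem mem_of_mem_support_condPick (hC : StaticCore P C) {S : Snapshot V}
    (hS : ∀ u ∈ C, ∀ v ∈ C, S.graph.Adj u v ↔ P.start.graph.Adj u v) {u v : V} (hu : u ∈ C)
    (hv : v ∈ (condPick C S u).support) : v ∈ C := by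
  unfold condPick at hv
  rw [dif_pos (exists_mem_support_pick hC hS hu)] at hv
  exact ((PMF.mem_support_filter_iff _).1 hv).1

/-- Conditioning renormalises the uniform law on all neighbours, so the current degree cancels and
only the core degree remains. Changes of the network outside the core therefore do not affect the
conditioned walk. -/
theorem condPick_apply (hC : StaticCore P C) {S : Snapshot V}
    (hS : ∀ u ∈ C, ∀ v ∈ C, S.graph.Adj u v ↔ P.start.graph.Adj u v) (u v : C) :
    condPick C S u v = ENNReal.ofReal (walkMatrix (P.coreGraph C) u v) := by
  have hne := nbrs_nonempty hC hS u.2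
  have hd : (P.coreGraph C).degree u ≠ 0 := by
    rw [degree_coreGraph]
    obtain ⟨x, hx, ha⟩ := hC.exists_adj u u.2
    exact (Finset.card_pos.2 ⟨x, Finset.mem_filter.2 ⟨hx, ha⟩⟩).ne'
  have hn0 : ((nbrs S u).card : ℝ≥0∞)⁻¹ ≠ 0 := by simp
  have hnt : ((nbrs S u).card : ℝ≥0∞)⁻¹ ≠ ∞ := by
    rw [Ne, ENNReal.inv_eq_top]
    exact_mod_cast hne.card_pos.ne'
  have hind : ∀ x, (C : Set V).indicator (pick S u) x =
      if x ∈ C.filter (fun v => P.start.graph.Adj u v) then ((nbrs S u).card : ℝ≥0∞)⁻¹ else 0 := by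
    intro x
    by_cases hx : x ∈ C
    · rw [Set.indicator_of_mem (by exact_mod_cast hx), pick_apply_of_nonempty hne]
      simp only [Finset.mem_filter, hS u u.2 x hx, hx, true_and]
    · rw [Set.indicator_of_notMem (by exact_mod_cast hx), if_neg fun h =>
        hx (Finset.mem_filter.1 h).1]
  unfold condPick
  rw [dif_pos (exists_mem_support_pick hC hS u.2), PMF.filter_apply]
  simp only [hind]
  rw [tsum_fintype, ← Finset.sum_filter, Finset.sum_const, Finset.filter_mem_eq_inter,
    Finset.univ_inter, ← degree_coreGraph, nsmul_eq_mul]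
  have hadj : (v : V) ∈ C.filter (fun v => P.start.graph.Adj u v) ↔ (P.coreGraph C).Adj u v := by
    rw [Finset.mem_filter, and_iff_right v.2]
    rfl
  unfold walkMatrix
  simp only [hadj]
  split_ifs
  · rw [ENNReal.mul_inv (Or.inr hnt) (Or.inr hn0), mul_comm, mul_assoc,
      ENNReal.inv_mul_cancel hn0 hnt, mul_one, one_div, ENNReal.ofReal_inv_of_pos (by positivity),
      ENNReal.ofReal_natCast]
  · simp

/-- The Chapman–Kolmogorov equation, split at the first step. -/
theorem expect_condPick_hitProb (hC : StaticCore P C) (hd : ∀ u, 0 < (P.coreGraph C).degree u)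
    {S : Snapshot V} (hS : ∀ u ∈ C, ∀ v ∈ C, S.graph.Adj u v ↔ P.start.graph.Adj u v) (u : C)
    (k : ℕ) {x : V} (hx : x ∈ C) :
    expect (condPick C S x) (hitProb P C u k) = hitProb P C u (k + 1) x := by
  unfold expect
  rw [tsum_fintype]
  have h₁ : ∑ y, condPick C S x y * hitProb P C u k y =
      ∑ y ∈ C, condPick C S x y * hitProb P C u k y := by
    refine (Finset.sum_subset (Finset.subset_univ C) fun y _ hy => ?_).symm
    unfold hitProb
    rw [dif_neg hy, mul_zero]
  rw [h₁, ← Finset.sum_coe_sort C (fun y => condPick C S x y * hitProb P C u k y)]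
  have hx' : hitProb P C u (k + 1) x =
      ENNReal.ofReal (stepProb (P.coreGraph C) (k + 1) ⟨x, hx⟩ u) := dif_pos hx
  rw [hx', stepProb_succ, ENNReal.ofReal_sum_of_nonneg]
  · refine Finset.sum_congr rfl fun y _ => ?_
    have hnn : 0 ≤ walkMatrix (P.coreGraph C) ⟨x, hx⟩ y := by
      unfold walkMatrix
      split_ifs <;> positivity
    rw [ENNReal.ofReal_mul hnn, ← condPick_apply hC hS ⟨x, hx⟩ y]
    congr 1
    exact dif_pos y.2
  · intro y _
    refine mul_nonneg ?_ (stepProb_nonneg hd _ _ _)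
    unfold walkMatrix
    split_ifs <;> positivity

/-- In the core-conditioned execution of `w`, the token `w` walks only in the core. -/
theorem walksIn_of_conditioned (hC : StaticCore P C) {w : V × ℕ} (hw : w.1 ∈ C) {r : ℕ}
    {h : History V} (hh : h ∈ (execution P (conditionedRule C w) r).support) : WalksIn C h w := by
  induction r generalizing h with
  | zero =>
    obtain ⟨s, hs, rfl⟩ := mem_support_startLaw hh
    rw [walksIn_cons]
    refine ⟨fun u v t ht hto => ?_, fun c hc => by simp at hc⟩
    rcases mem_outbox_handleAll hs ht with hk | ⟨hr, _, hv⟩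
    · simp at hk
    · obtain ⟨_, i, _, rfl⟩ := mem_created (mem_tokenList.1 hr)
      obtain rfl : (u, i) = w := by simpa using hto
      rw [conditionedRule, if_pos rfl] at hv
      exact ⟨hw, mem_of_mem_support_condPick hC (fun _ _ _ _ => Iff.rfl) hw hv⟩
  | succ r ih =>
    obtain ⟨c, h₀, h₁, ⟨_, c', hc', rfl⟩ | ⟨_, rfl⟩⟩ := mem_support_execution_succ hh
    · have hw₀ := ((walksIn_cons C).1 (ih h₁)).1
      refine (walksIn_cons C).2 ⟨fun u v t ht hto => ?_, ih h₁⟩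
      obtain ⟨s, hs, rfl⟩ := mem_support_walkRound hc'
      rcases mem_outbox_handleAll hs ht with hk | ⟨hr, _, hv⟩
      · exact hw₀ u v t (mem_kept hk).2 hto
      · obtain ⟨_, z, t₀, ht₀, rfl⟩ := mem_received.1 (mem_tokenList.1 hr)
        have hu : u ∈ C := (hw₀ z u t₀ (mem_accepted ht₀ hto).2.2 hto).2
        rw [conditionedRule, if_pos hto] at hv
        exact ⟨hu, mem_of_mem_support_condPick hC (hC.static _) hu hv⟩
    · exact (walksIn_cons C).2 ⟨((walksIn_cons C).1 (ih h₁)).1, ih h₁⟩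

/-- The conditional probability that `w` ends at `u`, given the buffers; summed over the copies. -/
def endLoad (P : Phase V) (C : Finset V) (w : V × ℕ) (u : C) : Buffers V → ℝ≥0∞ :=
  load (fun v t => if t.origin = some w then hitProb P C u (P.rwLength - (t.counter + 1)) v else 0)
    fun v t => if t.origin = some w ∧ v = u then 1 else 0

/-- A waiting token is weighed at its next node, with the step over the link already deducted from
the remaining length. Drawing that node averages the weight back to the one before the draw; a
finished token has weight `1` or `0` according to its end point. -/
theorem expect_endLoad_handleAll_le (hC : StaticCore P C)
    (hd : ∀ u, 0 < (P.coreGraph C).degree u) {S : Snapshot V}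
    (hS : ∀ u ∈ C, ∀ v ∈ C, S.graph.Adj u v ↔ P.start.graph.Adj u v) {w : V × ℕ} (u : C)
    {l : List (V × Token V)} (hl : ∀ x ∈ l, x.2.origin = some w → x.1 ∈ C) (s : Buffers V) :
    expect (handleAll P (conditionedRule C w) S l s) (endLoad P C w u) ≤
      endLoad P C w u s + (l.map fun x => if x.2.origin = some w then
        hitProb P C u (P.rwLength - x.2.counter) x.1 else 0).sum := by
  refine expect_load_handleAll_le (fun x hx hle => ?_) (fun x hx hlt => ?_) s
  · by_cases ho : x.2.origin = some w
    · simp only [ho, true_and, if_true]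
      rw [Nat.sub_eq_zero_of_le hle, hitProb_zero u (hl x hx ho)]
    · simp [ho]
  · by_cases ho : x.2.origin = some w
    · simp only [ho, if_true, conditionedRule]
      rw [expect_condPick_hitProb hC hd hS u _ (hl x hx ho)]
      refine le_of_eq ?_
      congr 1
      omega
    · simp only [ho, if_false]
      rw [expect_const]

/-- `endLoad` of the latest configuration. -/
def latestEndLoad (P : Phase V) (C : Finset V) (w : V × ℕ) (u : C) : History V → ℝ≥0∞
  | [] => 0
  | c :: _ => endLoad P C w u ⟨c.outbox, c.ended⟩

/-- Scheduling by the adversary leaves each waiting token's weight unchanged and draws preserve it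
on average; it can only drop when a token is lost. Hence the expectation never exceeds its value at
the source. -/
theorem expect_latestEndLoad_le (hC : StaticCore P C)
    (hd : ∀ u, 0 < (P.coreGraph C).degree u) {w : V × ℕ} (hw : w.1 ∈ C) (u : C) (r : ℕ) :
    expect (execution P (conditionedRule C w) r) (latestEndLoad P C w u) ≤
      hitProb P C u P.rwLength w.1 := by
  induction r with
  | zero =>
    rw [execution, startLaw_eq, expect_map]
    refine (expect_endLoad_handleAll_le hC hd (fun _ _ _ _ => Iff.rfl) u (fun x hx hto => ?_) _).trans
      ?_
    · obtain ⟨_, i, _, hi⟩ := mem_created (mem_tokenList.1 hx)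
      rw [hi] at hto
      have : (x.1, i) = w := Option.some.inj hto
      rw [← this] at hw
      exact hw
    · rw [endLoad, load_empty, zero_add]
      exact sum_created_le (by simp) fun v t ht => if_neg ht
  | succ r ih =>
    rw [execution, expect_bind]
    refine le_trans (expect_mono fun h hh => ?_) ih
    have hlen := length_of_mem_support hh
    have hw₀ := walksIn_of_conditioned hC hw hh
    match h, hlen with
    | c :: h, hlen =>
      simp only [nextRound]
      split_ifs
      · rw [expect_map, walkRound_eq, expect_map]
        refine (expect_endLoad_handleAll_le hC hd (hC.static _) u (fun x hx hto => ?_) _).trans ?_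
        · obtain ⟨_, z, t₀, ht₀, hx₂⟩ := mem_received.1 (mem_tokenList.1 hx)
          have hto₀ : t₀.origin = some w := by
            rw [hx₂] at hto
            exact hto
          exact (((walksIn_cons C).1 hw₀).1 z x.1 t₀ (mem_accepted ht₀ hto₀).2.2 hto₀).2
        · exact load_kept_add_received_le (fun _ _ _ => rfl) (fun _ t ht => by simp [ht]) _ _ _
      · rw [expect_pure]
        rfl

theorem toOuterMeasure_endsAt_le (hC : StaticCore P C)
    (hd : ∀ u, 0 < (P.coreGraph C).degree u) {w : V × ℕ} (hw : w.1 ∈ C) (u : C) (r : ℕ) :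
    (execution P (conditionedRule C w) r).toOuterMeasure {h | EndsAt h w u} ≤
      hitProb P C u P.rwLength w.1 := by
  refine (toOuterMeasure_le_expect fun h hh he => ?_).trans (expect_latestEndLoad_le hC hd hw u r)
  obtain ⟨c, hc, t, ht, hto⟩ := he
  match h, hc with
  | e :: h, hc =>
    have hte := ended_subset_head hh hc u ht
    have h₁ : 1 ≤ ((e.ended u).map fun t => if t.origin = some w ∧ (u : V) = u then
        (1 : ℝ≥0∞) else 0).sum := by
      refine List.single_le_sum (fun _ _ => zero_le) _ (List.mem_map.2 ⟨t, hte, ?_⟩)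
      simp [hto]
    refine h₁.trans (le_trans ?_ le_add_self)
    exact Finset.single_le_sum (f := fun x => ((e.ended x).map fun t =>
      if t.origin = some w ∧ x = u then (1 : ℝ≥0∞) else 0).sum) (fun _ _ => zero_le)
      (Finset.mem_univ (u : V))

/-- Up to the probability of long buffers, `w` ends like a simple random walk on the core. -/
theorem abs_endsAt_sub_stepProb_le (hC : StaticCore P C)
    (hd : ∀ u, 0 < (P.coreGraph C).degree u) {w : V × ℕ} (hw : w ∈ P.tokens C) (u : C)
    (hhalf : 2 * P.rwLength ≤ P.half) {δ : ℝ} (hδ : 0 ≤ δ)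
    (hq : (execution P (conditionedRule C w) P.half).toOuterMeasure
      {h | ¬ QueueBounded C P.cap h} ≤ ENNReal.ofReal δ) :
    |((P.condLaw C w).toOuterMeasure {h | EndsAt h w u}).toReal -
      stepProb (P.coreGraph C) P.rwLength ⟨w.1, (mem_tokens_iff.1 hw).1⟩ u| ≤ δ := by
  have hwC := (mem_tokens_iff.1 hw).1
  set p : C → ℝ := fun u => ((P.condLaw C w).toOuterMeasure {h | EndsAt h w u}).toReal with hp
  set q : C → ℝ := fun u => stepProb (P.coreGraph C) P.rwLength ⟨w.1, hwC⟩ u with hqdef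
  have hpq : ∀ x, p x ≤ q x := by
    intro x
    have := toOuterMeasure_endsAt_le hC hd hwC x (2 * P.half)
    unfold hitProb at this
    rw [dif_pos hwC] at this
    exact ENNReal.toReal_le_of_le_ofReal (stepProb_nonneg hd _ _ _) this
  have htop : ∀ x : C, (P.condLaw C w).toOuterMeasure {h | EndsAt h w x} ≠ ∞ := fun x =>
    ne_top_of_le_ne_top ENNReal.one_ne_top (toOuterMeasure_le_one _ _)
  -- Every outcome has a long buffer or an end point in the core. This lower bound for the total
  -- mass of `p` complements the pointwise upper bound `hpq`.
  have hone : (1 : ℝ≥0∞) ≤ ENNReal.ofReal δ +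
      ∑ x : C, (P.condLaw C w).toOuterMeasure {h | EndsAt h w x} := by
    rw [← toOuterMeasure_execution_drop P.half P.half, ← two_mul] at hq
    refine le_trans ?_ (add_le_add_left hq _)
    rw [Phase.condLaw, toOuterMeasure_eq_expect]
    simp only [toOuterMeasure_eq_expect _ {h | EndsAt h w _}]
    rw [← expect_sum, ← expect_add,
      ← expect_const (execution P (conditionedRule C w) (2 * P.half)) 1]
    refine expect_mono fun h hh => ?_
    by_cases hb : QueueBounded C P.cap (h.drop P.half)
    · have hdrop : h.drop P.half ∈ (execution P (conditionedRule C w) P.half).support :=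
        drop_mem_support (by rwa [← two_mul])
      obtain ⟨c, h', _, hc, x, hx, t, ht, hto, _⟩ := exists_ended (conditionedRule_support w) hC hw
        (k := P.half - 2 * P.rwLength) (by omega) hdrop (walksIn_of_conditioned hC hwC hdrop) hb
      have he : EndsAt h w x := ⟨c, List.mem_of_mem_drop hc, t, ht, hto⟩
      refine le_trans ?_ le_add_self
      refine le_trans ?_ (Finset.single_le_sum (f := fun y : C =>
        ({h | EndsAt h w y} : Set (History V)).indicator 1 h) (fun _ _ => zero_le)
        (Finset.mem_univ ⟨x, hx⟩))
      simp [he]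
    · refine le_trans ?_ le_self_add
      simp [hb]
  have hone' : 1 ≤ δ + ∑ x, p x := by
    have h₁ := ENNReal.toReal_mono (ENNReal.add_ne_top.2 ⟨ENNReal.ofReal_ne_top,
      ENNReal.sum_ne_top.2 fun x _ => htop x⟩) hone
    rw [ENNReal.toReal_add ENNReal.ofReal_ne_top (ENNReal.sum_ne_top.2 fun x _ => htop x),
      ENNReal.toReal_sum fun x _ => htop x, ENNReal.toReal_ofReal hδ, ENNReal.toReal_one] at h₁
    exact h₁
  have hq1 : ∑ x, q x = 1 := sum_stepProb hd _ _
  -- All differences `q x - p x` are nonnegative, so each is at most their sum, the missing mass.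
  have hle : q u - p u ≤ ∑ x, (q x - p x) :=
    Finset.single_le_sum (f := fun x => q x - p x) (fun x _ => sub_nonneg.2 (hpq x))
      (Finset.mem_univ u)
  rw [Finset.sum_sub_distrib, hq1] at hle
  rw [abs_le]
  have := hpq u
  change -δ ≤ p u - q u ∧ p u - q u ≤ δ
  constructor <;> linarith

end Conditioned

/-! ## The probability of long buffers -/

/-- From `exp y ≤ 1 / (1 - y)` at `y = x - x^2`, and `(1 - x + x^2)(1 + x) = 1 + x^3`. It bounds `(1
+ δ)^cap` from below with only a quadratic loss in the exponent, which keeps `g` near `1`. -/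
theorem exp_sub_sq_le {x : ℝ} (h₀ : 0 ≤ x) : Real.exp (x - x ^ 2) ≤ 1 + x := by
  have hpos : 0 < 1 - (x - x ^ 2) := by nlinarith
  have h := Real.add_one_le_exp (-(x - x ^ 2))
  have h' : (1 - (x - x ^ 2)) * Real.exp (x - x ^ 2) ≤ 1 := by
    calc _ ≤ Real.exp (-(x - x ^ 2)) * Real.exp (x - x ^ 2) := by
          gcongr
          linarith
      _ = 1 := by rw [← Real.exp_add]; simp
  have h'' : 1 ≤ (1 - (x - x ^ 2)) * (1 + x) := by nlinarith [pow_nonneg h₀ 3]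
  exact le_of_mul_le_mul_left (h'.trans h'') hpos

section Queue

variable {V : Type} [Fintype V] {P : Phase V} {rule : Rule V} {C : Finset V}

theorem toOuterMeasure_not_queueBounded_le_exp {w : V × ℕ}
    (hrule : ∀ S u t, t.origin ≠ some w → rule S u t = pick S u) (hC : StaticCore P C)
    (hinit : ∀ u ∈ C, P.init u ≤ P.cap) {N : ℕ} (hN : C.card ≤ N) :
    (execution P rule P.half).toOuterMeasure {h | ¬ QueueBounded C P.cap h} ≤
      ENNReal.ofReal (((P.half : ℝ) + 1) ^ 2 * (N : ℝ) ^ 2 *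
        Real.exp (1 / 4 - P.cap / (8 * ((P.half : ℝ) + 1)))) := by
  set R : ℝ := (P.half : ℝ) + 1 with hR
  have hR1 : 1 ≤ R := by
    rw [hR]
    linarith [Nat.cast_nonneg (α := ℝ) P.half]
  set δ : ℝ := 1 / (4 * R) with hδ
  have hδR : δ * R = 1 / 4 := by
    rw [hδ]
    field_simp
  have hδ0 : 0 < δ := by positivity
  have hδ4 : δ ≤ 1 / 4 := by nlinarith
  have hcap : (0 : ℝ) ≤ P.cap := Nat.cast_nonneg _
  set y : ℝ := (1 + δ) ^ P.cap with hy
  have hy0 : 0 < y := by positivity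
  set g : ℝ := Real.exp (δ + δ ^ 2 * P.cap) with hg
  have hy' : Real.exp ((δ - δ ^ 2) * P.cap) ≤ y := by
    rw [mul_comm, Real.exp_nat_mul]
    exact pow_le_pow_left₀ (Real.exp_nonneg _) (exp_sub_sq_le hδ0.le) _
  have hX : (1 : ℝ≥0∞) + ENNReal.ofReal δ = ENNReal.ofReal (1 + δ) := by
    rw [ENNReal.ofReal_add zero_le_one hδ0.le, ENNReal.ofReal_one]
  have hY : (1 + ENNReal.ofReal δ) ^ P.cap = ENNReal.ofReal y := by
    rw [hX, ← ENNReal.ofReal_pow (by positivity)]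
  have hG : ∀ d : ℕ, 0 < d → (1 + ENNReal.ofReal δ * (d : ℝ≥0∞)⁻¹) ^ (d * P.cap) ≤
      ENNReal.ofReal (Real.exp (δ * P.cap)) := by
    intro d hd
    have hd' : (0 : ℝ) < d := by exact_mod_cast hd
    have : (1 : ℝ≥0∞) + ENNReal.ofReal δ * (d : ℝ≥0∞)⁻¹ = ENNReal.ofReal (1 + δ / d) := by
      rw [ENNReal.ofReal_add zero_le_one (by positivity), ENNReal.ofReal_one, div_eq_mul_inv,
        ENNReal.ofReal_mul hδ0.le, ENNReal.ofReal_inv_of_pos hd', ENNReal.ofReal_natCast]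
    rw [this, ← ENNReal.ofReal_pow (by positivity)]
    refine ENNReal.ofReal_le_ofReal ?_
    calc (1 + δ / d) ^ (d * P.cap) ≤ Real.exp (δ / d) ^ (d * P.cap) := by
          gcongr
          linarith [Real.add_one_le_exp (δ / d)]
      _ = Real.exp (δ * P.cap) := by
          rw [← Real.exp_nat_mul]
          congr 1
          push_cast
          field_simp
  have hgY : (1 + ENNReal.ofReal δ) * ENNReal.ofReal (Real.exp (δ * P.cap)) ≤
      ENNReal.ofReal g * (1 + ENNReal.ofReal δ) ^ P.cap := by
    rw [hY, hX, ← ENNReal.ofReal_mul (by positivity), ← ENNReal.ofReal_mul (by positivity)]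
    refine ENNReal.ofReal_le_ofReal ?_
    calc (1 + δ) * Real.exp (δ * P.cap) ≤ Real.exp δ * Real.exp (δ * P.cap) := by
          gcongr
          linarith [Real.add_one_le_exp δ]
      _ = g * Real.exp ((δ - δ ^ 2) * P.cap) := by
          rw [hg, ← Real.exp_add, ← Real.exp_add]
          congr 1
          ring
      _ ≤ g * y := by gcongr
  have hg1 : 1 ≤ ENNReal.ofReal g := by
    rw [← ENNReal.ofReal_one]
    exact ENNReal.ofReal_le_ofReal (Real.one_le_exp (by positivity))
  have hB : ∀ r ≤ P.half, ∀ u ∈ C, ∀ v ∈ C,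
      expect (execution P rule r) (fun h => (1 + ENNReal.ofReal δ) ^ queueLength u v h) ≤
        ENNReal.ofReal (R * g ^ (P.half + 1) * y) := by
    intro r hr u hu v _
    refine (expect_pow_queueLength_le hrule hC hinit ENNReal.ofReal_ne_top hG hgY hg1 hu v hr).trans
      ?_
    rw [hY, ENNReal.ofReal_mul (by positivity), ENNReal.ofReal_mul (by positivity),
      ENNReal.ofReal_pow (by positivity)]
    gcongr
    · rw [hR, ENNReal.ofReal_add (by positivity) zero_le_one, ENNReal.ofReal_natCast,
        ENNReal.ofReal_one]
      gcongr
    · rw [ENNReal.ofReal_pow (by positivity)]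
      exact pow_le_pow_right₀ hg1 (by omega)
  refine (toOuterMeasure_not_queueBounded_le (by simp) (by simp) hB le_rfl).trans ?_
  have hfirst : ((P.half : ℝ≥0∞) + 1) = ENNReal.ofReal R := by
    rw [hR, ENNReal.ofReal_add (by positivity) zero_le_one, ENNReal.ofReal_natCast,
      ENNReal.ofReal_one]
  have hYY : ((1 + ENNReal.ofReal δ) ^ (2 * P.cap))⁻¹ = ENNReal.ofReal (y * y)⁻¹ := by
    rw [two_mul, pow_add, hY, ← ENNReal.ofReal_mul hy0.le,
      ENNReal.ofReal_inv_of_pos (by positivity)]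
  rw [hfirst, hYY, ← ENNReal.ofReal_mul (by positivity), ← ENNReal.ofReal_natCast C.card,
    ← ENNReal.ofReal_mul (by positivity), ← ENNReal.ofReal_mul (by positivity),
    ← ENNReal.ofReal_mul (by positivity)]
  refine ENNReal.ofReal_le_ofReal ?_
  have hNr : (C.card : ℝ) ≤ N := by exact_mod_cast hN
  have hgpow : g ^ (P.half + 1) = Real.exp (R * (δ + δ ^ 2 * P.cap)) := by
    rw [hg, ← Real.exp_nat_mul, hR]
    push_cast
    rfl
  have hyinv : y⁻¹ ≤ Real.exp (-((δ - δ ^ 2) * P.cap)) := by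
    rw [Real.exp_neg]
    gcongr
  calc R * (C.card * (C.card * (R * g ^ (P.half + 1) * y * (y * y)⁻¹)))
      = R ^ 2 * (C.card : ℝ) ^ 2 * (g ^ (P.half + 1) * y⁻¹) := by
        field_simp
    _ ≤ R ^ 2 * (N : ℝ) ^ 2 * (Real.exp (R * (δ + δ ^ 2 * P.cap)) *
          Real.exp (-((δ - δ ^ 2) * P.cap))) := by
        rw [hgpow]
        gcongr
    _ ≤ R ^ 2 * (N : ℝ) ^ 2 * Real.exp (1 / 4 - P.cap / (8 * R)) := by
        rw [← Real.exp_add]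
        gcongr
        have h₁ : (P.cap : ℝ) / (8 * R) = δ * P.cap / 2 := by
          rw [hδ]
          field_simp
          ring
        have h₂ : R * (δ + δ ^ 2 * P.cap) = 1 / 4 + δ * P.cap / 4 := by
          calc R * (δ + δ ^ 2 * P.cap) = δ * R + (δ * R) * δ * P.cap := by ring
            _ = _ := by rw [hδR]; ring
        have h₃ : δ ^ 2 * P.cap ≤ δ * P.cap / 4 := by
          nlinarith [mul_nonneg hδ0.le hcap]
        rw [h₁, h₂]
        nlinarith

end Queue

/-- The bound on the probability of long buffers is superpolynomially small. -/
theorem exists_failure_le {a η ρ : ℝ} (ha : 1 ≤ a) (hη : 1 ≤ η) (γ : ℝ) :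
    ∃ L₀ : ℝ, ∀ L ≥ L₀, ∀ N : ℕ, 1 ≤ N → Real.log N ≤ ρ * L →
      ((⌊η / 2 * L⌋₊ : ℝ) + 1) ^ 2 * (N : ℝ) ^ 2 *
        Real.exp (1 / 4 - ⌊a * L ^ 3⌋₊ / (8 * ((⌊η / 2 * L⌋₊ : ℝ) + 1))) ≤ (N : ℝ) ^ (-γ) := by
  -- The exponent is at least `L^2 / (16η)`, since the capacity is at least `L^3 / 2` and `R ≤ ηL`.
  -- The prefactors and `N^γ` contribute at most `(2η + (2 + |γ|)ρ)L`, and the last `+ 1` absorbs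
  -- the `1/4`.
  refine ⟨max 2 (16 * η * (2 * η + (2 + |γ|) * ρ + 1)), fun L hL N hN hlog => ?_⟩
  have hL2 : 2 ≤ L := (le_max_left _ _).trans hL
  have hLb : 16 * η * (2 * η + (2 + |γ|) * ρ + 1) ≤ L := (le_max_right _ _).trans hL
  set R : ℝ := (⌊η / 2 * L⌋₊ : ℝ) + 1 with hR
  have hR0 : 0 < R := by positivity
  have hRle : R ≤ η * L := by
    have := Nat.floor_le (show 0 ≤ η / 2 * L by positivity)
    nlinarith
  have hcap : L ^ 3 / 2 ≤ (⌊a * L ^ 3⌋₊ : ℝ) := by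
    have h₁ := Nat.lt_floor_add_one (a * L ^ 3)
    have h₂ : (2 : ℝ) ^ 3 ≤ L ^ 3 := by gcongr
    nlinarith
  have hN0 : (0 : ℝ) < N := by exact_mod_cast hN
  have hlog0 : 0 ≤ Real.log N := Real.log_natCast_nonneg N
  have hquot : L ^ 2 / (16 * η) ≤ ⌊a * L ^ 3⌋₊ / (8 * R) := by
    rw [div_le_div_iff₀ (by positivity) (by positivity)]
    calc L ^ 2 * (8 * R) ≤ L ^ 2 * (8 * (η * L)) := by gcongr
      _ = L ^ 3 / 2 * (16 * η) := by ring
      _ ≤ _ := by gcongr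
  have hN2 : (N : ℝ) ^ 2 = Real.exp (2 * Real.log N) := by
    rw [two_mul, Real.exp_add, Real.exp_log hN0, sq]
  have hR2 : R ^ 2 ≤ Real.exp (2 * (η * L)) := by
    rw [two_mul, Real.exp_add, ← sq]
    gcongr
    linarith [Real.add_one_le_exp (η * L)]
  rw [Real.rpow_def_of_pos hN0, hN2]
  calc _ ≤ Real.exp (2 * (η * L)) * Real.exp (2 * Real.log N) *
        Real.exp (1 / 4 - L ^ 2 / (16 * η)) := by gcongr
    _ ≤ _ := by
        rw [← Real.exp_add, ← Real.exp_add]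
        gcongr
        have h₁ : γ * Real.log N ≤ |γ| * (ρ * L) :=
          (mul_le_mul_of_nonneg_right (le_abs_self γ) hlog0).trans
            (mul_le_mul_of_nonneg_left hlog (abs_nonneg γ))
        have h₂ : (2 * η + (2 + |γ|) * ρ + 1) * L ≤ L ^ 2 / (16 * η) := by
          rw [le_div_iff₀ (by positivity)]
          nlinarith
        nlinarith

/-! ### Numerical bounds for the distribution of the end point -/

/-- The error splits into the probability of long buffers, at most `N^(-4)`, and the squared mixing
error, at most `N^(-5)`; for `N ≥ 4` each is at most a quarter of the allowance. -/
theorem abs_sub_le_of_two_step {N c p q s : ℝ} (hN : 4 ≤ N) (hcN : c ≤ N)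
    (h₁ : |p - q| ≤ N ^ (-4 : ℝ)) (h₂ : |q - s| ≤ c * (1 / N ^ 3 * (1 / N ^ 3))) :
    |p - s| ≤ 1 / N ^ 3 := by
  have hN0 : 0 < N := by linarith
  have h4 : N ^ (-4 : ℝ) ≤ 1 / 4 * (1 / N ^ 3) := by
    rw [Real.rpow_neg hN0.le, show (4 : ℝ) = (4 : ℕ) by norm_num, Real.rpow_natCast, ← one_div,
      div_mul_div_comm, one_mul]
    refine one_div_le_one_div_of_le (by positivity) ?_
    rw [pow_succ' N 3]
    gcongr
    exact_mod_cast hN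
  have h5 : c * (1 / N ^ 3 * (1 / N ^ 3)) ≤ 1 / 4 * (1 / N ^ 3) := by
    calc c * (1 / N ^ 3 * (1 / N ^ 3)) ≤ N * (1 / N ^ 3 * (1 / N ^ 3)) := by gcongr
      _ = 1 / N ^ 2 * (1 / N ^ 3) := by field_simp
      _ ≤ 1 / 4 * (1 / N ^ 3) := by
          gcongr
          nlinarith
  have h3 : 0 ≤ 1 / N ^ 3 := by positivity
  refine (abs_sub_le p q s).trans ((add_le_add h₁ h₂).trans ?_)
  linarith

/-- Below, the error takes at most half of `1 / ((Δ + 1)c)`; above, it adds at most `1/c` to `Δ/c`.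
Passing between `c` and `N` costs a factor `2`. -/
theorem bounds_of_close {N c p s Δ : ℝ} (hN : 4 ≤ N) (hc : 0 < c) (hcN : c ≤ N)
    (hNc : N ≤ 2 * c) (hΔ : 1 ≤ Δ) (hNΔ : 2 * (Δ + 1) ≤ N) (hps : |p - s| ≤ 1 / N ^ 3)
    (hlo : 1 / (Δ * c) ≤ s) (hhi : s ≤ Δ / c) :
    1 / (2 * (Δ + 1)) / c ≤ p ∧ p ≤ 2 * (Δ + 1) / c ∧
      1 / (2 * (Δ + 1)) / N ≤ p ∧ p ≤ 2 * (Δ + 1) / N := by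
  have hN0 : 0 < N := by linarith
  obtain ⟨hpl, hpu⟩ := abs_le.1 hps
  have hN3 : N * N ≤ N ^ 3 := by
    rw [pow_succ, sq]
    exact le_mul_of_one_le_right (by positivity) (by linarith)
  have hsmall : 1 / N ^ 3 ≤ 1 / (2 * (Δ + 1)) / c := by
    rw [div_div]
    refine one_div_le_one_div_of_le (by positivity) (le_trans ?_ hN3)
    gcongr
  have hlow : 1 / (2 * (Δ + 1)) / c ≤ p := by
    have h₁ : 1 / ((Δ + 1) * c) ≤ 1 / (Δ * c) := by
      refine one_div_le_one_div_of_le (by positivity) ?_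
      gcongr
      linarith
    have h₂ : 1 / ((Δ + 1) * c) = 2 * (1 / (2 * (Δ + 1)) / c) := by
      field_simp
    linarith
  have hup : p ≤ (Δ + 1) / c := by
    have h₁ : 1 / N ^ 3 ≤ 1 / c := by
      refine one_div_le_one_div_of_le hc (le_trans ?_ hN3)
      nlinarith
    rw [add_div]
    linarith
  refine ⟨hlow, hup.trans ?_, le_trans ?_ hlow, hup.trans ?_⟩
  · gcongr
    linarith
  · gcongr
  · rw [div_le_div_iff₀ hc hN0]
    calc (Δ + 1) * N ≤ (Δ + 1) * (2 * c) := by gcongr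
      _ = 2 * (Δ + 1) * c := by ring

/-! ## Size of the core -/

section Main

variable {V : Type} [Fintype V] {P : Phase V} {C : Finset V}

theorem IsCore.card_le {φ f : ℝ} {Δ K : ℕ} (hC : IsCore P C φ Δ K f) :
    C.card ≤ P.start.alive.card := Finset.card_le_card hC.alive_start

/-- The size hypotheses speak of possible histories, so one history in the support is chosen; it
shows that fewer than half of the initial nodes, or at most half, are outside the core. -/
theorem IsCore.half_le_card {φ f : ℝ} {Δ K : ℕ} (hC : IsCore P C φ Δ K f)
    (hf : 2 * (K + 1) * f ≤ P.start.alive.card) : (P.start.alive.card : ℝ) ≤ 2 * C.card := by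
  obtain ⟨h, hh⟩ := P.law.support_nonempty
  have h₁ : ((P.start.alive \ C).card : ℝ) ≤
      K * ((P.byzStart.card + (churned h).card : ℕ) : ℝ) := by exact_mod_cast hC.size h hh
  have h₂ := hC.few h hh
  have h₃ : ((P.start.alive \ C).card : ℝ) + C.card = P.start.alive.card := by
    exact_mod_cast Finset.card_sdiff_add_card_eq_card hC.alive_start
  have h₄ : (0 : ℝ) ≤ ((P.byzStart.card + (churned h).card : ℕ) : ℝ) := Nat.cast_nonneg _
  have h₅ : (K : ℝ) * ((P.byzStart.card + (churned h).card : ℕ) : ℝ) ≤ K * f := by gcongr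
  nlinarith

theorem IsCore.degree_coreGraph_pos {φ f : ℝ} {Δ K : ℕ} (hC : IsCore P C φ Δ K f) (hφ : 0 < φ)
    (h2 : 2 ≤ C.card) (u : C) : 0 < (P.coreGraph C).degree u :=
  degree_pos_of_conductance hφ hC.expander (by simpa using h2) u

theorem IsCore.degree_coreGraph_le {φ f : ℝ} {Δ K : ℕ} (hC : IsCore P C φ Δ K f) (u : C) :
    (P.coreGraph C).degree u ≤ Δ := by
  rw [degree_coreGraph]
  refine (Finset.card_le_card fun v hv => ?_).trans (hC.degree_start u)
  exact adj_iff_mem_nbrs.2 (Finset.mem_filter.1 hv).2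

theorem IsCore.staticCore {φ f : ℝ} {Δ K : ℕ} (hC : IsCore P C φ Δ K f) (hφ : 0 < φ)
    (h2 : 2 ≤ C.card) : StaticCore P C where
  honest := hC.honest
  alive_start := hC.alive_start
  static := hC.static
  exists_adj u hu := by
    have := hC.degree_coreGraph_pos hφ h2 ⟨u, hu⟩
    rw [degree_coreGraph, Finset.card_pos] at this
    obtain ⟨v, hv⟩ := this
    exact ⟨v, (Finset.mem_filter.1 hv).1, (Finset.mem_filter.1 hv).2⟩

theorem IsCore.sum_alive_sdiff_le {φ f : ℝ} {Δ K : ℕ} (hC : IsCore P C φ Δ K f) {h : History V}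
    (hh : h ∈ P.law.support) (B : ℕ) :
    (h.map fun c => (c.net.alive \ C).card * B).sum ≤
      (2 * P.half + 1) * ((2 * K + 1) * ((P.byzEnd h).card + (churned h).card) * B) := by
  refine (List.sum_le_card_nsmul _
    ((2 * K + 1) * ((P.byzEnd h).card + (churned h).card) * B) fun x hx => ?_).trans (le_of_eq ?_)
  · obtain ⟨c, hc, rfl⟩ := List.mem_map.1 hx
    exact Nat.mul_le_mul_right _ (card_alive_sdiff_le hh (hC.size h hh) hc)
  · rw [List.length_map, length_of_mem_support hh, smul_eq_mul]

theorem kappa_mul (n : ℕ) (h : History V) (hC : C.Nonempty) :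
    kappa P C n h * numtokens n * C.card =
      ((P.byzEnd h).card + (churned h).card) * Real.log n * numtokens n := by
  have : (C.card : ℝ) ≠ 0 := by exact_mod_cast hC.card_pos.ne'
  unfold kappa
  field_simp

end Main

end ByzWalk

end

/-! ### Choice of the constants and conclusion -/

theorem theorem2 (φ b ρ : ℝ) (hφ : 0 < φ) (hb : 0 < b) (hρ : 0 < ρ) (Δ K : ℕ)
    (f : ℕ → ℝ) (hf : f =o[Filter.atTop] fun N : ℕ => (N : ℝ)) :
    ∃ a₀ η₀ : ℝ, ∀ a ≥ a₀, ∀ η ≥ η₀, ∃ K₁ c₁ c₂ : ℝ, 0 < c₁ ∧ 0 < c₂ ∧ ∀ γ : ℝ, ∃ n₀ : ℕ,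
    ∀ n ≥ n₀, ∀ (V : Type) [Fintype V] (P : ByzWalk.Phase V) (C : Finset V) (N τ : ℕ),
      -- the network size `N` is polynomially related to the parameter `n` of the protocol
      P.start.alive.card = N → Real.log N ≤ ρ * Real.log n → Real.log n ≤ ρ * Real.log N →
      -- the core and its mixing time
      ByzWalk.IsCore P C φ Δ K (f N) →
      ByzWalk.MixedBy (P.coreGraph C) (1 / (N : ℝ) ^ 3) τ → (τ : ℝ) ≤ b * Real.log n →
      -- the parameters of the protocol
      P.cap = ⌊a * Real.log n ^ 3⌋₊ → P.rwLength = 2 * τ → P.half = ⌊η / 2 * Real.log n⌋₊ →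
      (∀ v, v ∉ P.byz → P.init v ≤ ByzWalk.numtokens n) →
      -- with high probability:
      P.law.toOuterMeasure {h | ¬ (
          ((ByzWalk.crossings C h : ℝ)
            ≤ K₁ * (ByzWalk.kappa P C n h * ByzWalk.numtokens n * C.card)) ∧
          (((P.tokens C).card : ℝ) - K₁ * (ByzWalk.kappa P C n h * ByzWalk.numtokens n * C.card)
            ≤ (((P.tokens C).filter fun w => ByzWalk.WalksIn C h w).card : ℝ)) ∧
          (∀ w ∈ P.tokens C, ByzWalk.WalksIn C h w →
            ByzWalk.WalkedBy h w P.rwLength τ ∧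
            ∃ u ∈ C, ByzWalk.EndedBy h w (2 * P.rwLength) P.rwLength u ∧
              ByzWalk.BackBy h w (2 * P.half) u))}
        ≤ ENNReal.ofReal ((N : ℝ) ^ (-γ)) ∧
      -- the distribution of the end of the walk
      (∀ w ∈ P.tokens C, ∀ u : C,
        let p : ℝ := ((P.condLaw C w).toOuterMeasure {h | ByzWalk.EndsAt h w u}).toReal
        |p - ByzWalk.stationary (P.coreGraph C) u| ≤ 1 / (N : ℝ) ^ 3 ∧
        c₁ / (C.card : ℝ) ≤ p ∧ p ≤ c₂ / (C.card : ℝ) ∧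
        c₁ / (N : ℝ) ≤ p ∧ p ≤ c₂ / (N : ℝ)) := by
  -- `a ≥ 1` makes the capacity at least the number of created tokens per node; `η ≥ 8b` gives `2 *
  -- rwLength = 4τ ≤ (η/2) log n`.
  refine ⟨1, max 1 (8 * b), fun a ha η hη => ?_⟩
  have hη1 : 1 ≤ η := (le_max_left _ _).trans hη
  have hη8 : 8 * b ≤ η := (le_max_right _ _).trans hη
  have ha1 : 1 ≤ a := ha
  -- The factors come from the number of configurations, at most `(η + 1) log n`, the nodes outside
  -- the core, and their degree. The last factor is the sum of the escape constant `2aΔ + 1` and the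
  -- crossing constant `4a`, using `cap ≤ 2a * numtokens`.
  refine ⟨(η + 1) * (2 * K + 1) * Δ * (2 * a * Δ + 1 + 4 * a), 1 / (2 * (Δ + 1)), 2 * (Δ + 1),
    by positivity, by positivity, fun γ => ?_⟩
  obtain ⟨L₁, hL₁⟩ := ByzWalk.exists_failure_le (ρ := ρ) ha1 hη1 γ
  obtain ⟨L₂, hL₂⟩ := ByzWalk.exists_failure_le (ρ := ρ) ha1 hη1 4
  obtain ⟨N₁, hN₁⟩ : ∃ N₁ : ℕ, ∀ N ≥ N₁, 2 * (K + 1) * f N ≤ N := by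
    have := hf.def (show (0 : ℝ) < 1 / (2 * (K + 1)) by positivity)
    obtain ⟨N₁, hN₁⟩ := Filter.eventually_atTop.1 this
    refine ⟨N₁, fun N hN => ?_⟩
    have h := (le_abs_self (f N)).trans (hN₁ N hN)
    rw [Real.norm_natCast] at h
    calc 2 * ((K : ℝ) + 1) * f N ≤ 2 * (K + 1) * (1 / (2 * (K + 1)) * N) := by gcongr
      _ = N := by field_simp
  -- `N₁` makes the core at least half of the network; `2Δ + 4` ensures `N ≥ 4`, `N ≥ 2(Δ + 1)` and
  -- at least two core nodes.
  set N₂ : ℕ := max N₁ (2 * Δ + 4) with hN₂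
  obtain ⟨n₀, hn₀⟩ := Filter.eventually_atTop.1 ((Real.tendsto_log_atTop.comp
    tendsto_natCast_atTop_atTop).eventually_ge_atTop
      (max (max L₁ L₂) (max 2 (ρ * Real.log N₂)) : ℝ))
  refine ⟨n₀, fun n hn V _ P C N τ hN hlog₁ hlog₂ hC hmix hτ hcap hrw hhalf hinit => ?_⟩
  have hL := hn₀ n hn
  simp only [Function.comp_apply, max_le_iff] at hL
  obtain ⟨⟨hLL₁, hLL₂⟩, hL2, hLN⟩ := hL
  set L := Real.log n with hLdef
  -- Since `Real.log 0 = 0`, `N = 0` would force `L ≤ 0`.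
  have hNpos : 1 ≤ N := by
    by_contra h0
    have : N = 0 := by omega
    rw [this, Nat.cast_zero, Real.log_zero] at hlog₂
    linarith
  have hNr : (0 : ℝ) < N := by exact_mod_cast hNpos
  have hNN₂ : N₂ ≤ N := by
    have h₁ : Real.log N₂ ≤ Real.log N := le_of_mul_le_mul_left (hLN.trans hlog₂) hρ
    have h₂ : (0 : ℝ) < N₂ := by
      have : 2 * Δ + 4 ≤ N₂ := le_max_right _ _
      exact_mod_cast (by omega : 0 < N₂)
    exact_mod_cast (Real.log_le_log_iff h₂ hNr).1 h₁
  have hNΔ : 2 * Δ + 4 ≤ N := (le_max_right _ _).trans hNN₂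
  have hCN : C.card ≤ N := hN ▸ hC.card_le
  have hNC : (N : ℝ) ≤ 2 * C.card := by
    rw [← hN]
    refine hC.half_le_card ?_
    rw [hN]
    exact hN₁ N ((le_max_left _ _).trans hNN₂)
  have hC2 : 2 ≤ C.card := by
    have : N ≤ 2 * C.card := by exact_mod_cast hNC
    omega
  have hS := hC.staticCore hφ hC2
  have hd := hC.degree_coreGraph_pos hφ hC2
  have hne : C.Nonempty := Finset.card_pos.1 (by omega)
  have hL3 : (8 : ℝ) ≤ L ^ 3 := by
    calc (8 : ℝ) = 2 ^ 3 := by norm_num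
      _ ≤ L ^ 3 := by gcongr
  have hnt : L ^ 3 ≤ 2 * ByzWalk.numtokens n := by
    have := Nat.lt_floor_add_one (L ^ 3)
    unfold ByzWalk.numtokens
    linarith
  have hcapr : (P.cap : ℝ) ≤ 2 * a * ByzWalk.numtokens n := by
    rw [hcap]
    calc _ ≤ a * L ^ 3 := Nat.floor_le (by positivity)
      _ ≤ a * (2 * ByzWalk.numtokens n) := by gcongr
      _ = _ := by ring
  have hinitcap : ∀ u ∈ C, P.init u ≤ P.cap := by
    intro u hu
    refine (hinit u (hS.notMem_byz hu)).trans ?_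
    rw [hcap]
    exact Nat.floor_le_floor (le_mul_of_one_le_left (by positivity) ha1)
  have hhalfr : (P.half : ℝ) ≤ η / 2 * L := by
    rw [hhalf]
    exact Nat.floor_le (by positivity)
  have hrounds : 2 * P.rwLength ≤ P.half := by
    rw [hrw, hhalf]
    refine Nat.le_floor ?_
    push_cast
    nlinarith
  have hfail : ∀ (rule : ByzWalk.Rule V) (w : V × ℕ),
      (∀ S u t, t.origin ≠ some w → rule S u t = ByzWalk.pick S u) →
      ∀ γ' : ℝ, (∀ N : ℕ, 1 ≤ N → Real.log N ≤ ρ * L →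
      ((⌊η / 2 * L⌋₊ : ℝ) + 1) ^ 2 * (N : ℝ) ^ 2 *
        Real.exp (1 / 4 - ⌊a * L ^ 3⌋₊ / (8 * ((⌊η / 2 * L⌋₊ : ℝ) + 1))) ≤ (N : ℝ) ^ (-γ')) →
      (ByzWalk.execution P rule P.half).toOuterMeasure
        {h | ¬ ByzWalk.QueueBounded C P.cap h} ≤ ENNReal.ofReal ((N : ℝ) ^ (-γ')) := by
    intro rule w hrule γ' hγ'
    refine (ByzWalk.toOuterMeasure_not_queueBounded_le_exp hrule hS hinitcap hCN).trans
      (ENNReal.ofReal_le_ofReal ?_)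
    have := hγ' N hNpos hlog₁
    rwa [← hhalf, ← hcap] at this
  constructor
  · obtain ⟨v, hv⟩ := hne
    -- The protocol treats no token specially, so any label can serve as the exceptional one.
    refine le_trans ?_ (hfail ByzWalk.protocolRule (v, 0) (fun _ _ _ _ => rfl) γ (hL₁ L hLL₁))
    rw [← ByzWalk.toOuterMeasure_execution_drop P.half P.half, ← two_mul]
    refine ByzWalk.toOuterMeasure_mono_support fun h hh hbad hq => hbad ?_
    rw [ByzWalk.kappa_mul n h ⟨v, hv⟩]
    set X : ℝ := ((P.byzEnd h).card : ℝ) + (ByzWalk.churned h).card with hX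
    set M : ℝ := (ByzWalk.numtokens n : ℝ) with hM
    have hX0 : 0 ≤ X := by positivity
    have hM0 : 0 ≤ M := Nat.cast_nonneg _
    have hround : 2 * (P.half : ℝ) + 1 ≤ (η + 1) * L := by nlinarith
    have hbound : ∀ B : ℕ, ∀ β : ℝ, (B : ℝ) ≤ Δ * (β * M) → β ≤ 2 * a * Δ + 1 + 4 * a →
        (((h.map fun c => (c.net.alive \ C).card * B).sum : ℕ) : ℝ) ≤
          (η + 1) * (2 * K + 1) * Δ * (2 * a * Δ + 1 + 4 * a) * (X * L * M) := by
      intro B β hB hβ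
      have h₁ : (((h.map fun c => (c.net.alive \ C).card * B).sum : ℕ) : ℝ) ≤
          (2 * P.half + 1) * ((2 * K + 1) * X * B) := by
        rw [hX]
        exact_mod_cast hC.sum_alive_sdiff_le hh B
      calc _ ≤ (2 * (P.half : ℝ) + 1) * ((2 * K + 1) * X * B) := h₁
        _ ≤ ((η + 1) * L) * ((2 * K + 1) * X * (Δ * ((2 * a * Δ + 1 + 4 * a) * M))) := by
            gcongr
            exact hB.trans (by gcongr)
        _ = _ := by ring
    refine ⟨?_, ?_, fun w hw hwalk => ByzWalk.walked_ended_back ByzWalk.protocolRule_support hS hw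
      hrw hrounds hh hwalk hq⟩
    · refine le_trans (Nat.cast_le.2 (ByzWalk.crossings_le C hC.degree_start hC.degree hh))
        (hbound _ (4 * a) ?_ (by nlinarith [Nat.cast_nonneg (α := ℝ) Δ]))
      push_cast
      exact mul_le_mul_of_nonneg_left (by linarith) (Nat.cast_nonneg Δ)
    · have hesc := ByzWalk.card_escaped_le (C := C) ByzWalk.protocolRule_support hC.degree_start
        hC.degree hinit hh
      have h₁ := hbound (Δ * (Δ * P.cap + ByzWalk.numtokens n)) (2 * a * Δ + 1) (by
        push_cast
        refine mul_le_mul_of_nonneg_left ?_ (Nat.cast_nonneg Δ)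
        linarith [mul_le_mul_of_nonneg_left hcapr (Nat.cast_nonneg (α := ℝ) Δ)]) (by linarith)
      have h₂ := (Nat.cast_le (α := ℝ).2 hesc).trans h₁
      have h₃ : (((P.tokens C).filter fun w => ByzWalk.WalksIn C h w).card : ℝ) +
          ((P.tokens C).filter fun w => ¬ ByzWalk.WalksIn C h w).card = (P.tokens C).card := by
        exact_mod_cast Finset.card_filter_add_card_filter_not _
      linarith
  · intro w hw u p
    have hwC := (ByzWalk.mem_tokens_iff.1 hw).1
    have h₁ := ByzWalk.abs_endsAt_sub_stepProb_le hS hd hw u hrounds (by positivity)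
      (hfail (ByzWalk.conditionedRule C w) w ByzWalk.conditionedRule_of_ne 4 (hL₂ L hLL₂))
    have h₂ := ByzWalk.stepProb_two_mul_sub_stationary_le hd hmix ⟨w.1, hwC⟩ u
    obtain ⟨hlo, hhi⟩ := ByzWalk.stationary_bounds hd hC.degree_coreGraph_le u
    rw [Fintype.card_coe] at h₂ hlo hhi
    rw [← hrw] at h₂
    have hN4 : (4 : ℝ) ≤ N := by exact_mod_cast (by omega : 4 ≤ N)
    have hC0 : (0 : ℝ) < C.card := by exact_mod_cast hne.card_pos
    have hCNr : (C.card : ℝ) ≤ N := by exact_mod_cast hCN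
    have hΔ : (1 : ℝ) ≤ Δ := by exact_mod_cast (hd u).trans_le (hC.degree_coreGraph_le u)
    have hNΔr : 2 * ((Δ : ℝ) + 1) ≤ N := by exact_mod_cast (by omega : 2 * (Δ + 1) ≤ N)
    have hclose := ByzWalk.abs_sub_le_of_two_step hN4 hCNr h₁ h₂
    exact ⟨hclose, ByzWalk.bounds_of_close hN4 hC0 hCNr hNC hΔ hNΔr hclose hlo hhi⟩
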